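/- Let $V$ be a finite-dimensional vector space over a finite field $K$, equipped with a form $F$ of one of the following types: a nondegenerate alternating bilinear form (symplectic case); a nondegenerate quadratic form, in any characteristic, meaning that the form is nonzero at every nonzero vector of the radical of its polar form and this radical has dimension at most $1$ (orthogonal case); or a nondegenerate Hermitian form with respect to an automorphism of $K$ of order two (unitary case). A subspace is totally singular if $F$ vanishes identically on it. The polar space of $F$ consists of the totally singular subspaces; its points are those of dimension $1$, and two points are collinear if their span is totally singular. Assume that the polar space has rank at least $2$, i.e. that there is a totally singular subspace of dimension at least $2$. Let $G$ be a classical group acting on the set $\Omega$ of points: a group of permutations of $\Omega$ preserving collinearity and non-collinearity, and containing all permutations induced by the derived subgroup of the group of isometries of $F$ (for example, the group induced by the full symplectic, orthogonal or unitary group, by its subgroup of elements of determinant $1$, by its derived subgroup, or by the corresponding group of similarities or semisimilarities). The group $G$ is called synchronizing if, for every map $a:\Omega\to\Omega$ that is not a permutation, the semigroup $\langle a,G\rangle$ contains a map of rank $1$ (image of size $1$). An ovoid is a set of points meeting every maximal totally singular subspace in exactly one point; a spread is a set of maximal totally singular subspaces such that every point lies in exactly one of them. Then $G$ is non-synchronizing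 if and only if either the polar space possesses both an ovoid and a spread, or the set of points of the polar space can be partitioned into ovoids. -/

import Mathlib

open scoped LinearAlgebra.Projectivization

/-! ### Synchronizing permutation groups -/

/-- A transformation semigroup is synchronizing if it contains an element of rank `1`,
that is, a map whose image has exactly one element. -/
def IsSynchronizingSemigroup {Ω : Type*} (S : Subsemigroup (Function.End Ω)) : Prop :=
  ∃ f ∈ S, (Set.range (f : Ω → Ω)).ncard = 1

/-- The semigroup `⟨a, G⟩` of maps `Ω → Ω` (under composition) generated by the map `a`
and the permutations in `G`. -/
def semigroupGenerated {Ω : Type*} (G : Subgroup (Equiv.Perm Ω)) (a : Ω → Ω) :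
    Subsemigroup (Function.End Ω) :=
  Subsemigroup.closure {f : Function.End Ω | f = a ∨ ∃ g ∈ G, f = (g : Ω → Ω)}

/-- A permutation group `G` is synchronizing if, for every map `a` which is not a permutation,
the semigroup `⟨a, G⟩` contains an element of rank `1`. -/
def IsSynchronizingGroup {Ω : Type*} (G : Subgroup (Equiv.Perm Ω)) : Prop :=
  ∀ a : Ω → Ω, ¬ Function.Bijective a → IsSynchronizingSemigroup (semigroupGenerated G a)

/-! ### Classical forms, their polar spaces and their groups -/

/-- A nondegenerate form of one of the three classical types on the vector space `V`:
an alternating bilinear form, a quadratic form (in any characteristic), or a Hermitian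
sesquilinear form with respect to an automorphism `σ` of `K` of order two. -/
inductive ClassicalForm (K V : Type*) [Field K] [AddCommGroup V] [Module K V] where
  | symplectic (B : LinearMap.BilinForm K V) (alt : B.IsAlt) (nondeg : B.Nondegenerate)
  | orthogonal (Q : QuadraticForm K V) (nondeg : Q.Nondegenerate)
  | unitary (σ : K →+* K) (invol : ∀ a, σ (σ a) = a) (nontriv : σ ≠ RingHom.id K)
      (H : V →ₛₗ[σ] V →ₗ[K] K) (herm : H.IsSymm) (nondeg : H.Nondegenerate)

namespace ClassicalForm

variable {K V : Type*} [Field K] [AddCommGroup V] [Module K V]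

/-- A subspace is totally singular (totally isotropic) if the form vanishes identically on it. -/
def IsTotallySingular (F : ClassicalForm K V) (W : Submodule K V) : Prop :=
  match F with
  | symplectic B _ _ => ∀ x ∈ W, ∀ y ∈ W, B x y = 0
  | orthogonal Q _ => ∀ x ∈ W, Q x = 0
  | unitary _ _ _ H _ _ => ∀ x ∈ W, ∀ y ∈ W, H x y = 0

/-- A linear automorphism is an isometry if it preserves the form. -/
def IsIsometry (F : ClassicalForm K V) (g : V ≃ₗ[K] V) : Prop :=
  match F with
  | symplectic B _ _ => ∀ x y, B (g x) (g y) = B x y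
  | orthogonal Q _ => ∀ x, Q (g x) = Q x
  | unitary _ _ _ H _ _ => ∀ x y, H (g x) (g y) = H x y

/-- The group of all isometries: the symplectic group, the (full) orthogonal group or the
(full) unitary group of the form. -/
def isometryGroup (F : ClassicalForm K V) : Subgroup (V ≃ₗ[K] V) where
  carrier := {g | F.IsIsometry g}
  one_mem' := by cases F <;> simp [IsIsometry]
  mul_mem' := by
    intro a b ha hb
    cases F <;> simp_all [IsIsometry]
  inv_mem' := by
    intro a ha
    cases F with
    | symplectic B _ _ =>
      intro x y
      have h := ha (a.symm x) (a.symm y)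
      simpa using h.symm
    | orthogonal Q _ =>
      intro x
      have h := ha (a.symm x)
      simpa using h.symm
    | unitary _ _ _ H _ _ =>
      intro x y
      have h := ha (a.symm x) (a.symm y)
      simpa using h.symm

/-- The points of the polar space: the totally singular points of the projective space. -/
def Point (F : ClassicalForm K V) : Type _ :=
  {p : ℙ K V // F.IsTotallySingular p.submodule}

/-- The one-dimensional totally singular subspace corresponding to a point. -/
def Point.submodule {F : ClassicalForm K V} (p : F.Point) : Submodule K V :=
  p.1.submodule

theorem isTotallySingular_map {F : ClassicalForm K V} {g : V ≃ₗ[K] V} (hg : F.IsIsometry g)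
    {W : Submodule K V} (hW : F.IsTotallySingular W) :
    F.IsTotallySingular (W.map (g : V →ₗ[K] V)) := by
  cases F with
  | symplectic B _ _ =>
    rintro _ ⟨x, hx, rfl⟩ _ ⟨y, hy, rfl⟩
    exact (hg x y).trans (hW x hx y hy)
  | orthogonal Q _ =>
    rintro _ ⟨x, hx, rfl⟩
    exact (hg x).trans (hW x hx)
  | unitary _ _ _ H _ _ =>
    rintro _ ⟨x, hx, rfl⟩ _ ⟨y, hy, rfl⟩
    exact (hg x y).trans (hW x hx y hy)

theorem submodule_smul (g : V ≃ₗ[K] V) (p : ℙ K V) :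
    (g • p).submodule = p.submodule.map (g : V →ₗ[K] V) := by
  induction p using Projectivization.ind with
  | h v hv =>
    rw [Projectivization.smul_mk, Projectivization.submodule_mk, Projectivization.submodule_mk,
      Submodule.map_span, Set.image_singleton]
    rfl

/-- The isometry group acts on the points of the polar space by `⟨v⟩ ↦ ⟨g v⟩`. -/
instance (F : ClassicalForm K V) : MulAction F.isometryGroup F.Point where
  smul g p := ⟨(g : V ≃ₗ[K] V) • p.1, by
    rw [submodule_smul]; exact isTotallySingular_map g.2 p.2⟩
  one_smul p := Subtype.ext (one_smul (V ≃ₗ[K] V) p.1)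
  mul_smul g h p := Subtype.ext (mul_smul (g : V ≃ₗ[K] V) (h : V ≃ₗ[K] V) p.1)

/-- Two points are collinear if they lie in a common totally singular subspace. -/
def Collinear (F : ClassicalForm K V) (p q : F.Point) : Prop :=
  F.IsTotallySingular (p.submodule ⊔ q.submodule)

/-- A permutation of the points is an automorphism of the polar space if it and its inverse
preserve collinearity. -/
def IsAutomorphism (F : ClassicalForm K V) (g : Equiv.Perm F.Point) : Prop :=
  ∀ p q : F.Point, F.Collinear (g p) (g q) ↔ F.Collinear p q

/-- `G` is a classical group acting on the points of the polar space of `F`: a group of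
automorphisms of the polar space that contains all permutations of the points induced by the
derived subgroup of the isometry group. The permutation groups induced by the isometry group
itself, by its subgroup of elements of determinant one, by its derived subgroup, and by
the groups of similarities and semisimilarities are all of this form. -/
def IsClassicalGroup (F : ClassicalForm K V) (G : Subgroup (Equiv.Perm F.Point)) : Prop :=
  (commutator F.isometryGroup).map (MulAction.toPermHom F.isometryGroup F.Point) ≤ G ∧
    ∀ g ∈ G, F.IsAutomorphism g

/-! ### Ovoids and spreads -/

/-- A maximal totally singular subspace. -/
def IsMaximalSingular (F : ClassicalForm K V) (W : Submodule K V) : Prop :=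
  Maximal F.IsTotallySingular W

/-- An ovoid: a set of points meeting every maximal totally singular subspace in exactly
one point. -/
def IsOvoid (F : ClassicalForm K V) (O : Set F.Point) : Prop :=
  ∀ W : Submodule K V, F.IsMaximalSingular W → ∃! p : F.Point, p ∈ O ∧ p.submodule ≤ W

/-- A spread: a set of maximal totally singular subspaces such that every point lies in exactly
one of them. -/
def IsSpread (F : ClassicalForm K V) (S : Set (Submodule K V)) : Prop :=
  (∀ W ∈ S, F.IsMaximalSingular W) ∧
    ∀ p : F.Point, ∃! W : Submodule K V, W ∈ S ∧ p.submodule ≤ W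

/-- A partition of the set of all points into ovoids. -/
def IsOvoidPartition (F : ClassicalForm K V) (P : Set (Set F.Point)) : Prop :=
  Setoid.IsPartition P ∧ ∀ O ∈ P, F.IsOvoid O

end ClassicalForm

/-!
A permutation group `G` on a finite set is non-synchronizing exactly if some nontrivial
`G`-invariant graph has a proper colouring whose colour set is a clique of the graph. One direction
is obvious, as such a colouring followed by the inclusion of the clique is an endomorphism of the
graph. For the other one, take a map `a`, not a permutation, such that `⟨a, G⟩` has no element of
rank one, join two points if no element of `⟨a, G⟩` identifies them, and colour the points by an
element of minimal rank (`exists_relation_of_not_isSynchronizingGroup`).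

On the points of a polar space a classical group has only two nontrivial invariant graphs, the
collinearity graph and its complement (`IsClassicalGroup.relation_eq`). A colouring of the
collinearity graph by a clique is a partition into ovoids, as all maximal totally singular
subspaces have the same number of points (`exists_isOvoidPartition`). A colouring of the complement
by a clique attains the bound `|A| |B| ≤ |Ω|` for a clique `A` and a coclique `B` of a graph with a
transitive group, and hence gives an ovoid, its image, and a spread, its fibres
(`exists_isOvoid_isSpread`).

For the rank three property, let `x` and `y` be singular vectors that are not orthogonal. In all
three types, one formula defines an isometry `t` that moves `x` to `y` along `y - x` and fixes all
vectors orthogonal to `y - x` (`exists_isometry_along`). These isometries already act transitively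
on pairs of vectors. Transitivity descends to the derived subgroup because suitable commutators
`[k, t]` act on given points as `t` does, or move `x` to `y` through a point collinear with neither
(`Thick.exists_commutator_fixing`, `Thick.exists_commutator_moving`). The argument requires a third
point, collinear with neither of two given points, in the residue of a point. Only the hyperbolic
quadric in a four-dimensional space lacks such points; the derived subgroup need not have rank three
there, but this quadric has an ovoid and a spread (`thick_or_exists_isOvoid_isSpread`).
-/

namespace ClassicalForm

variable {K V : Type*} [Field K] [AddCommGroup V] [Module K V]

/-! ### A common language for the three types of forms -/

/-- The sesquilinear form attached to a classical form: the form itself in the symplectic and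
unitary cases, the polar form in the orthogonal case. -/
def pairing (F : ClassicalForm K V) (x y : V) : K :=
  match F with
  | symplectic B _ _ => B x y
  | orthogonal Q _ => QuadraticMap.polar Q x y
  | unitary _ _ _ H _ _ => H x y

/-- The field automorphism with respect to which `pairing` is semilinear in its first argument. -/
def conj (F : ClassicalForm K V) : K →+* K :=
  match F with
  | symplectic _ _ _ => RingHom.id K
  | orthogonal _ _ => RingHom.id K
  | unitary σ _ _ _ _ _ => σ

/-- A vector is singular if the line it spans is totally singular. -/
def IsSingular (F : ClassicalForm K V) (x : V) : Prop :=
  match F with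
  | symplectic _ _ _ => True
  | orthogonal Q _ => Q x = 0
  | unitary _ _ _ H _ _ => H x x = 0

variable (F : ClassicalForm K V)

theorem pairing_add_left (x y z : V) :
    F.pairing (x + y) z = F.pairing x z + F.pairing y z := by
  cases F <;> simp [pairing, QuadraticMap.polar_add_left]

theorem pairing_add_right (x y z : V) :
    F.pairing x (y + z) = F.pairing x y + F.pairing x z := by
  cases F <;> simp [pairing, QuadraticMap.polar_add_right]

theorem pairing_smul_left (c : K) (x y : V) :
    F.pairing (c • x) y = F.conj c * F.pairing x y := by
  cases F <;> simp [pairing, conj, QuadraticMap.polar_smul_left]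

theorem pairing_smul_right (c : K) (x y : V) :
    F.pairing x (c • y) = c * F.pairing x y := by
  cases F <;> simp [pairing, QuadraticMap.polar_smul_right]

theorem pairing_zero_right (x : V) : F.pairing x 0 = 0 := by
  simpa using F.pairing_smul_right 0 x 0

theorem pairing_neg_right (x y : V) : F.pairing x (-y) = -F.pairing x y := by
  simpa using F.pairing_smul_right (-1) x y

theorem pairing_neg_left (x y : V) : F.pairing (-x) y = -F.pairing x y := by
  simpa using F.pairing_smul_left (-1) x y

theorem pairing_sub_left (x y z : V) :
    F.pairing (x - y) z = F.pairing x z - F.pairing y z := by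
  rw [sub_eq_add_neg, pairing_add_left, pairing_neg_left, sub_eq_add_neg]

theorem pairing_sub_right (x y z : V) :
    F.pairing x (y - z) = F.pairing x y - F.pairing x z := by
  rw [sub_eq_add_neg, pairing_add_right, pairing_neg_right, sub_eq_add_neg]

/-- The linear functional `F.pairing x`. -/
def pairingLin (x : V) : V →ₗ[K] K where
  toFun := F.pairing x
  map_add' := F.pairing_add_right x
  map_smul' c y := F.pairing_smul_right c x y

@[simp] theorem pairingLin_apply (x y : V) : F.pairingLin x y = F.pairing x y := rfl

theorem conj_conj (c : K) : F.conj (F.conj c) = c := by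
  cases F <;> simp_all [conj]

theorem conj_ne_zero {c : K} (hc : c ≠ 0) : F.conj c ≠ 0 := by simpa using hc

variable {F}

theorem pairing_symm_zero {x y : V} (h : F.pairing x y = 0) : F.pairing y x = 0 := by
  cases F with
  | symplectic B alt _ => exact (LinearMap.IsAlt.isRefl alt) x y h
  | orthogonal Q _ =>
    simp only [pairing] at h ⊢
    rwa [QuadraticMap.polar_comm]
  | unitary σ _ _ H herm _ => exact herm.isRefl x y h

theorem pairing_symm_ne {x y : V} (h : F.pairing x y ≠ 0) : F.pairing y x ≠ 0 :=
  fun h' => h (pairing_symm_zero h')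

theorem IsSingular.pairing_self {x : V} (h : F.IsSingular x) : F.pairing x x = 0 := by
  cases F with
  | symplectic B alt _ => exact alt x
  | orthogonal Q _ =>
    simp only [IsSingular] at h
    simp [pairing, QuadraticMap.polar_self, h]
  | unitary σ _ _ H herm _ => exact h

theorem IsSingular.smul {x : V} (h : F.IsSingular x) (c : K) : F.IsSingular (c • x) := by
  cases F <;> simp_all [IsSingular, QuadraticMap.map_smul]

theorem IsSingular.add {x y : V} (hx : F.IsSingular x) (hy : F.IsSingular y)
    (h : F.pairing x y = 0) : F.IsSingular (x + y) := by
  have h' := pairing_symm_zero h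
  cases F with
  | symplectic B alt _ => trivial
  | orthogonal Q _ =>
    simp only [IsSingular, pairing] at *
    rw [QuadraticMap.map_add Q, hx, hy, h]; simp
  | unitary σ _ _ H herm _ =>
    simp only [IsSingular, pairing] at *
    simp [hx, hy, h, h']

theorem IsSingular.sub {x y : V} (hx : F.IsSingular x) (hy : F.IsSingular y)
    (h : F.pairing x y = 0) : F.IsSingular (x - y) := by
  have := hx.add (hy.smul (-1)) (by rw [pairing_smul_right, h, mul_zero])
  simpa [sub_eq_add_neg] using this

theorem isTotallySingular_iff {W : Submodule K V} :
    F.IsTotallySingular W ↔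
      (∀ x ∈ W, F.IsSingular x) ∧ ∀ x ∈ W, ∀ y ∈ W, F.pairing x y = 0 := by
  cases F with
  | symplectic B alt _ => simp [IsTotallySingular, IsSingular, pairing]
  | orthogonal Q _ =>
    simp only [IsTotallySingular, IsSingular, pairing]
    refine ⟨fun h => ⟨h, fun x hx y hy => ?_⟩, fun h => h.1⟩
    simp [QuadraticMap.polar, h x hx, h y hy, h _ (W.add_mem hx hy)]
  | unitary σ _ _ H herm _ =>
    simp only [IsTotallySingular, IsSingular, pairing]
    exact ⟨fun h => ⟨fun x hx => h x hx x hx, h⟩, fun h => h.2⟩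

/-- The form is nondegenerate on singular vectors. In the orthogonal case the polar form may have
a radical, but this radical contains no nonzero singular vector. -/
theorem IsSingular.eq_zero {x : V} (hx : F.IsSingular x) (h : ∀ y, F.pairing x y = 0) :
    x = 0 := by
  cases F with
  | symplectic B alt nd => exact nd.1 x h
  | orthogonal Q nd =>
    have : x ∈ Q.radical := ⟨hx, LinearMap.ext h⟩
    rwa [nd.radical_eq_bot, Submodule.mem_bot] at this
  | unitary σ _ _ H herm nd => exact nd.1 x h

theorem IsSingular.exists_pairing_ne {x : V} (hx : F.IsSingular x) (h0 : x ≠ 0) :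
    ∃ y, F.pairing x y ≠ 0 := by
  by_contra! h
  exact h0 (hx.eq_zero h)

/-- A vector that is not orthogonal to the singular vector `x` can be made singular by adding a
multiple of `x`. -/
theorem IsSingular.exists_singular_add_smul {x y : V} (hx : F.IsSingular x)
    (h : F.pairing x y ≠ 0) : ∃ c : K, F.IsSingular (y + c • x) := by
  have h' := pairing_symm_ne h
  cases F with
  | symplectic B alt nd => exact ⟨0, trivial⟩
  | orthogonal Q nd =>
    simp only [IsSingular, pairing] at *
    refine ⟨-Q y / QuadraticMap.polar Q y x, ?_⟩
    rw [QuadraticMap.map_add Q, QuadraticMap.map_smul, hx, QuadraticMap.polar_smul_right]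
    rw [smul_eq_mul (-Q y / _), div_mul_cancel₀ _ h']
    simp
  | unitary σ invol nontriv H herm nd =>
    simp only [IsSingular, pairing] at *
    -- The value `H y y` is fixed by `σ`, hence is the trace of a multiple of an element `d` of
    -- nonzero trace.
    obtain ⟨d, hd⟩ : ∃ d, d + σ d ≠ 0 := by
      by_contra! hd
      refine nontriv (RingHom.ext fun a => ?_)
      have h2 : (1 : K) + 1 = 0 := by simpa using hd 1
      have ha := hd a
      have : a + a = 0 := by linear_combination a * h2
      rw [RingHom.id_apply]
      linear_combination ha - this
    have hyy : σ (H y y) = H y y := herm.eq y y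
    have hxy : σ (H y x) = H x y := herm.eq y x
    have hc : d + σ d = σ d + σ (σ d) := by rw [invol]; ring
    refine ⟨-(H y y * d / (d + σ d)) / H y x, ?_⟩
    have hd' : σ d + d ≠ 0 := by rwa [add_comm]
    simp only [map_add, LinearMap.add_apply, map_smul, LinearMap.map_smulₛₗ, LinearMap.smul_apply,
      smul_eq_mul, map_div₀, map_neg, map_mul, invol, hyy, hxy, hx]
    field_simp
    ring

theorem IsIsometry.pairing_eq {g : V ≃ₗ[K] V} (hg : F.IsIsometry g) (x y : V) :
    F.pairing (g x) (g y) = F.pairing x y := by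
  cases F with
  | symplectic B alt nd => exact hg x y
  | orthogonal Q nd =>
    simp only [pairing, QuadraticMap.polar]
    rw [← map_add, hg, hg, hg]
  | unitary σ invol nontriv H herm nd => exact hg x y

theorem IsIsometry.isSingular {g : V ≃ₗ[K] V} (hg : F.IsIsometry g) {x : V}
    (hx : F.IsSingular x) : F.IsSingular (g x) := by
  cases F with
  | symplectic B alt nd => trivial
  | orthogonal Q nd => exact (hg x).trans hx
  | unitary σ invol nontriv H herm nd => exact (hg x x).trans hx

/-! ### Isometries exchanging singular vectors -/

/-- For singular vectors `x`, `y` that are not orthogonal, there is an isometry that moves `x` to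
`y` along `y - x` and fixes all vectors orthogonal to `y - x`: a transvection in the symplectic
case, a reflection in the orthogonal case, a transvection or quasi-reflection in the unitary
case. -/
theorem exists_isometry_along [Module.Finite K V] {x y : V} (hx : F.IsSingular x)
    (hy : F.IsSingular y) (h : F.pairing x y ≠ 0) :
    ∃ t : F.isometryGroup, ∀ z, (t : V ≃ₗ[K] V) z =
      z + (F.pairing (y - x) z / F.pairing (y - x) x) • (y - x) := by
  have h' := pairing_symm_ne h
  have hb : F.pairing (y - x) x = F.pairing y x := by
    rw [pairing_sub_left, hx.pairing_self, sub_zero]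
  have hvv : F.pairing (y - x) (y - x) = -(F.pairing x y + F.pairing y x) := by
    rw [pairing_sub_left, pairing_sub_right, pairing_sub_right, hx.pairing_self, hy.pairing_self]
    ring
  let t : V →ₗ[K] V := LinearMap.id +
    ((F.pairing y x)⁻¹ • F.pairingLin (y - x)).smulRight (y - x)
  have ht : ∀ z, t z = z + (F.pairing (y - x) z / F.pairing y x) • (y - x) := by
    intro z
    simp [t, div_eq_inv_mul]
  have hinj : Function.Injective t := by
    rw [injective_iff_map_eq_zero]
    intro z hz
    have hz' := hz
    rw [ht] at hz
    have h1 : F.pairing (y - x) (z + (F.pairing (y - x) z / F.pairing y x) • (y - x)) = 0 := by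
      rw [hz, pairing_zero_right]
    rw [pairing_add_right, pairing_smul_right, hvv] at h1
    have h2 : F.pairing (y - x) z = 0 := by
      field_simp at h1
      have : F.pairing x y * F.pairing (y - x) z = 0 := by linear_combination -h1
      exact (mul_eq_zero.1 this).resolve_left h
    simpa [h2] using hz
  refine ⟨⟨LinearEquiv.ofInjectiveEndo t hinj, ?_⟩, fun z => ?_⟩
  swap
  · rw [hb]; exact ht z
  change F.IsIsometry _
  have ht' : ∀ z, LinearEquiv.ofInjectiveEndo t hinj z =
    z + (F.pairing (y - x) z / F.pairing y x) • (y - x) := ht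
  generalize LinearEquiv.ofInjectiveEndo t hinj = g at ht'
  clear ht t hinj
  generalize hv : y - x = v at *
  cases F with
  | symplectic B alt nd =>
    intro z w
    simp only [pairing] at *
    rw [ht', ht']
    have h1 : B z v = -B v z := (LinearMap.IsAlt.neg alt v z).symm
    have h2 : B v v = 0 := alt v
    simp only [map_add, LinearMap.add_apply, map_smul, LinearMap.smul_apply, smul_eq_mul, h1, h2]
    ring
  | orthogonal Q nd =>
    intro z
    simp only [pairing] at *
    have hv2 : Q v = -QuadraticMap.polar Q y x := by
      have hx' : Q x = 0 := hx
      have hy' : Q y = 0 := hy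
      rw [← hv, sub_eq_add_neg, QuadraticMap.map_add Q, QuadraticMap.polar_neg_right,
        QuadraticMap.map_neg, hx', hy']
      ring
    rw [ht', QuadraticMap.map_add Q, QuadraticMap.map_smul, QuadraticMap.polar_smul_right, hv2,
      QuadraticMap.polar_comm Q z v]
    simp only [smul_eq_mul]
    field_simp
    ring
  | unitary σ invol nontriv H herm nd =>
    intro z w
    simp only [pairing] at *
    have h1 : H z v = σ (H v z) := (herm.eq v z).symm
    have h3 : σ (H y x) = H x y := herm.eq y x
    rw [ht', ht']
    simp only [map_add, LinearMap.add_apply, map_smul, LinearMap.map_smulₛₗ, LinearMap.smul_apply,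
      smul_eq_mul, map_div₀, h1, hvv, h3]
    field_simp
    ring

theorem exists_isometry_moving [Module.Finite K V] {x y : V} (hx : F.IsSingular x)
    (hy : F.IsSingular y) (h : F.pairing x y ≠ 0) :
    ∃ t : F.isometryGroup, t.1 x = y ∧ ∀ z, F.pairing (y - x) z = 0 → t.1 z = z := by
  obtain ⟨t, ht⟩ := exists_isometry_along hx hy h
  refine ⟨t, ?_, fun z hz => by rw [ht, hz]; simp⟩
  have hb : F.pairing (y - x) x ≠ 0 := by
    rw [pairing_sub_left, hx.pairing_self, sub_zero]
    exact pairing_symm_ne h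
  rw [ht, div_self hb, one_smul, add_sub_cancel]

theorem isometryGroup_apply_mul (g h : F.isometryGroup) (x : V) : (g * h).1 x = g.1 (h.1 x) := rfl

theorem isometryGroup_inv_apply_eq {g : F.isometryGroup} {x y : V} (h : g.1 x = y) :
    (g⁻¹).1 y = x := by
  rw [← h]
  exact LinearEquiv.symm_apply_apply g.1 x

theorem isometryGroup_apply_inv (g : F.isometryGroup) (x : V) : g.1 ((g⁻¹).1 x) = x :=
  LinearEquiv.apply_symm_apply g.1 x

theorem pairing_apply_apply (g : F.isometryGroup) (x y : V) :
    F.pairing (g.1 x) (g.1 y) = F.pairing x y :=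
  IsIsometry.pairing_eq g.2 x y

theorem pairing_apply_inv (g : F.isometryGroup) (x y : V) :
    F.pairing x ((g⁻¹).1 y) = F.pairing (g.1 x) y := by
  rw [← pairing_apply_apply g, isometryGroup_apply_inv]

theorem IsSingular.apply {x : V} (hx : F.IsSingular x) (g : F.isometryGroup) :
    F.IsSingular (g.1 x) :=
  IsIsometry.isSingular g.2 hx

/-! ### Singular vectors in general position -/

/-- The functionals attached to two independent singular vectors are independent. The vector `p`
may be zero. -/
theorem exists_orthogonal_not_orthogonal {p y : V} (hp : F.IsSingular p) (hy : F.IsSingular y)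
    (hpy : F.pairing p y = 0) (hind : ∀ c : K, y ≠ c • p) :
    ∃ x, F.pairing p x = 0 ∧ F.pairing y x ≠ 0 := by
  by_cases hp0 : p = 0
  · obtain ⟨x, hx⟩ := hy.exists_pairing_ne (by simpa using hind 0)
    exact ⟨x, by simpa [hp0] using F.pairing_smul_left 0 0 x, hx⟩
  obtain ⟨x0, hx0⟩ := hp.exists_pairing_ne hp0
  -- Subtract from `y` the multiple of `p` that makes it orthogonal to `x0`.
  set c := F.conj (F.pairing y x0 / F.pairing p x0) with hc
  have hy0 : F.IsSingular (y - c • p) :=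
    hy.sub (hp.smul c) (by rw [pairing_smul_right, pairing_symm_zero hpy, mul_zero])
  obtain ⟨x, hx⟩ := hy0.exists_pairing_ne (sub_ne_zero.2 (hind c))
  refine ⟨x - (F.pairing p x / F.pairing p x0) • x0, ?_, ?_⟩
  · rw [pairing_sub_right, pairing_smul_right, div_mul_cancel₀ _ hx0, sub_self]
  · convert hx using 1
    rw [pairing_sub_right, pairing_smul_right, pairing_sub_left, pairing_smul_left, hc, conj_conj]
    ring

/-- Two singular vectors that are orthogonal to each other and to the singular vector `p`, but are
not multiples of `p`, are both non-orthogonal to some singular vector orthogonal to `p`. The vector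
`p` may be zero. -/
theorem exists_singular_not_orthogonal {p y y' : V} (hp : F.IsSingular p) (hy : F.IsSingular y)
    (hy' : F.IsSingular y') (hpy : F.pairing p y = 0) (hpy' : F.pairing p y' = 0)
    (hyy' : F.pairing y y' = 0) (hind : ∀ c : K, y ≠ c • p) (hind' : ∀ c : K, y' ≠ c • p) :
    ∃ r, F.IsSingular r ∧ F.pairing p r = 0 ∧ F.pairing y r ≠ 0 ∧ F.pairing y' r ≠ 0 := by
  obtain ⟨r, h1, h2, h3⟩ : ∃ r, F.pairing p r = 0 ∧ F.pairing y r ≠ 0 ∧ F.pairing y' r ≠ 0 := by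
    obtain ⟨r, h1, h2⟩ := exists_orthogonal_not_orthogonal hp hy hpy hind
    obtain ⟨r', h1', h2'⟩ := exists_orthogonal_not_orthogonal hp hy' hpy' hind'
    by_cases h3 : F.pairing y' r = 0
    · by_cases h3' : F.pairing y r' = 0
      · exact ⟨r + r', by rw [pairing_add_right, h1, h1', add_zero],
          by rwa [pairing_add_right, h3', add_zero], by rwa [pairing_add_right, h3, zero_add]⟩
      · exact ⟨r', h1', h3', h2'⟩
    · exact ⟨r, h1, h2, h3⟩
  obtain ⟨c, hc⟩ := hy.exists_singular_add_smul h2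
  refine ⟨r + c • y, hc, ?_, ?_, ?_⟩
  · rw [pairing_add_right, pairing_smul_right, h1, hpy, mul_zero, add_zero]
  · rwa [pairing_add_right, pairing_smul_right, hy.pairing_self, mul_zero, add_zero]
  · rwa [pairing_add_right, pairing_smul_right, pairing_symm_zero hyy', mul_zero, add_zero]

theorem exists_singular_not_orthogonal_pair {y y' : V} (hy : F.IsSingular y)
    (hy' : F.IsSingular y') (hyy' : F.pairing y y' = 0) (h0 : y ≠ 0) (h0' : y' ≠ 0) :
    ∃ r, F.IsSingular r ∧ F.pairing y r ≠ 0 ∧ F.pairing y' r ≠ 0 := by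
  have h00 : F.IsSingular (0 : V) := by simpa using hy.smul 0
  have hz : ∀ z, F.pairing 0 z = 0 := fun z => by simpa using F.pairing_smul_left 0 0 z
  obtain ⟨r, hr, -, h⟩ := exists_singular_not_orthogonal h00 hy hy' (hz _) (hz _) hyy'
    (by simpa using h0) (by simpa using h0')
  exact ⟨r, hr, h⟩

/-- The isometry group is transitive on the nonzero singular vectors. -/
theorem exists_isometry_apply_eq [Module.Finite K V] {x y : V} (hx : F.IsSingular x)
    (hy : F.IsSingular y) (hx0 : x ≠ 0) (hy0 : y ≠ 0) : ∃ g : F.isometryGroup, g.1 x = y := by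
  by_cases h : F.pairing x y = 0
  · obtain ⟨r, hr, h1, h2⟩ := exists_singular_not_orthogonal_pair hx hy h hx0 hy0
    obtain ⟨s, hs, -⟩ := exists_isometry_moving hx hr h1
    obtain ⟨t, ht, -⟩ := exists_isometry_moving hr hy (pairing_symm_ne h2)
    exact ⟨t * s, by rw [isometryGroup_apply_mul, hs, ht]⟩
  · obtain ⟨t, ht, -⟩ := exists_isometry_moving hx hy h
    exact ⟨t, ht⟩

variable (F) in
/-- The polar space of `F` has rank at least two. -/
def RankTwo : Prop := ∃ W : Submodule K V, F.IsTotallySingular W ∧ 2 ≤ Module.finrank K W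

/-- In rank at least two, every nonzero singular vector `x` is orthogonal to some singular vector
that is not a multiple of `x`. -/
theorem RankTwo.exists_orthogonal [Module.Finite K V] (hF : F.RankTwo) {x : V}
    (hx : F.IsSingular x) (hx0 : x ≠ 0) :
    ∃ y, F.IsSingular y ∧ F.pairing x y = 0 ∧ ∀ c : K, y ≠ c • x := by
  obtain ⟨W, hW, hdim⟩ := hF
  rw [isTotallySingular_iff] at hW
  obtain ⟨u, hu⟩ := (Module.finrank_pos_iff_exists_ne_zero (R := K) (M := W)).1 (by omega)
  have hu0 : (u : V) ≠ 0 := by simpa using hu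
  obtain ⟨v, hv⟩ : ∃ v : W, ∀ c : K, c • u ≠ v := by
    by_contra! h
    have := finrank_le_one u h
    omega
  obtain ⟨g, hg⟩ := exists_isometry_apply_eq (hW.1 u u.2) hx hu0 hx0
  refine ⟨g.1 v, (hW.1 v v.2).apply g, ?_, fun c hc => hv c ?_⟩
  · rw [← hg, pairing_apply_apply, hW.2 u u.2 v v.2]
  · rw [← hg, ← map_smul] at hc
    exact Subtype.ext (g.1.injective hc).symm

theorem RankTwo.exists_orthogonal_pair [Module.Finite K V] (hF : F.RankTwo) {x y : V}
    (hx : F.IsSingular x) (h : F.pairing x y ≠ 0) :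
    ∃ e, F.IsSingular e ∧ e ≠ 0 ∧ F.pairing x e = 0 ∧ F.pairing y e = 0 := by
  have hx0 : x ≠ 0 := by
    rintro rfl
    exact pairing_symm_ne h (F.pairing_zero_right y)
  obtain ⟨s, hs, hxs, hne⟩ := hF.exists_orthogonal hx hx0
  refine ⟨s - (F.pairing y s / F.pairing y x) • x, ?_, sub_ne_zero.2 (hne _), ?_, ?_⟩
  · exact hs.sub (hx.smul _) (by rw [pairing_smul_right, pairing_symm_zero hxs, mul_zero])
  · rw [pairing_sub_right, pairing_smul_right, hxs, hx.pairing_self, mul_zero, sub_zero]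
  · rw [pairing_sub_right, pairing_smul_right, div_mul_cancel₀ _ (pairing_symm_ne h), sub_self]

/-- The plane spanned by two non-orthogonal singular vectors is an orthogonal summand. -/
theorem exists_orthogonal_projection {x y : V} (hx : F.IsSingular x) (hy : F.IsSingular y)
    (h : F.pairing x y ≠ 0) (z : V) :
    ∃ a b : K, F.pairing x (z - a • x - b • y) = 0 ∧ F.pairing y (z - a • x - b • y) = 0 := by
  have h' := pairing_symm_ne h
  refine ⟨F.pairing y z / F.pairing y x, F.pairing x z / F.pairing x y, ?_, ?_⟩
  · rw [pairing_sub_right, pairing_sub_right, pairing_smul_right, pairing_smul_right,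
      hx.pairing_self, div_mul_cancel₀ _ h]
    ring
  · rw [pairing_sub_right, pairing_sub_right, pairing_smul_right, pairing_smul_right,
      hy.pairing_self, div_mul_cancel₀ _ h']
    ring

/-- If `x` and `y` are not orthogonal, a singular vector `e` orthogonal to both has a partner
orthogonal to both. -/
theorem exists_hyperbolic_partner {x y e : V} (hx : F.IsSingular x) (hy : F.IsSingular y)
    (h : F.pairing x y ≠ 0) (he : F.IsSingular e) (he0 : e ≠ 0) (hxe : F.pairing x e = 0)
    (hye : F.pairing y e = 0) (a : K) :
    ∃ f, F.IsSingular f ∧ F.pairing e f = a ∧ F.pairing x f = 0 ∧ F.pairing y f = 0 := by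
  obtain ⟨f0, hf0⟩ := he.exists_pairing_ne he0
  obtain ⟨α, β, h1, h2⟩ := exists_orthogonal_projection hx hy h f0
  set f1 := f0 - α • x - β • y with hf1
  have h3 : F.pairing e f1 = F.pairing e f0 := by
    rw [hf1, pairing_sub_right, pairing_sub_right, pairing_smul_right, pairing_smul_right,
      pairing_symm_zero hxe, pairing_symm_zero hye]
    ring
  obtain ⟨c, hc⟩ := he.exists_singular_add_smul (h3 ▸ hf0 : F.pairing e f1 ≠ 0)
  refine ⟨(a / F.pairing e f0) • (f1 + c • e), hc.smul _, ?_, ?_, ?_⟩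
  · rw [pairing_smul_right, pairing_add_right, pairing_smul_right, he.pairing_self, h3, mul_zero,
      add_zero, div_mul_cancel₀ _ hf0]
  · rw [pairing_smul_right, pairing_add_right, pairing_smul_right, h1, hxe]; ring
  · rw [pairing_smul_right, pairing_add_right, pairing_smul_right, h2, hye]; ring

/-! ### Transitivity of the derived subgroup -/

variable (F) in
/-- The polar space of `F` is thick: if the points `y` and `y'` of the residue of `p` are not
collinear, there is a third point `y + m + c y'` of the residue collinear with neither. The case
`p = 0`, in which the residue is the whole polar space, is included. -/
def Thick : Prop :=
  ∀ p y y' : V, F.IsSingular p → F.IsSingular y → F.IsSingular y' → F.pairing p y = 0 →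
    F.pairing p y' = 0 → F.pairing y y' ≠ 0 →
    ∃ m : V, ∃ c : K, c ≠ 0 ∧ F.pairing p m = 0 ∧ F.pairing y m = 0 ∧ F.pairing y' m = 0 ∧
      F.IsSingular (y + m + c • y')

/-- Two orthogonal vectors `x` and `y` with the same nonzero pairing with `r` are both
non-orthogonal to some `z` with this pairing. Thickness is applied to the residue of `y - x`, which
contains both `x` and `r`. -/
theorem Thick.exists_between (hF : F.Thick) {r x y : V} (hr : F.IsSingular r)
    (hx : F.IsSingular x) (hy : F.IsSingular y) (hrx : F.pairing r x ≠ 0)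
    (hxy' : F.pairing r x = F.pairing r y) (hxy : F.pairing x y = 0) :
    ∃ z, F.IsSingular z ∧ F.pairing r z = F.pairing r x ∧ F.pairing x z ≠ 0 ∧
      F.pairing z y ≠ 0 := by
  have hyx := pairing_symm_zero hxy
  have hry : F.pairing r y ≠ 0 := hxy' ▸ hrx
  obtain ⟨m, c, hc, h1, h2, h3, h4⟩ := hF (y - x) x r (hy.sub hx hyx) hx hr
    (by rw [pairing_sub_left, hyx, hx.pairing_self, sub_zero])
    (pairing_symm_zero (by rw [pairing_sub_right, hxy', sub_self])) (pairing_symm_ne hrx)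
  rw [pairing_sub_left, h2, sub_zero] at h1
  refine ⟨x + m + c • r, h4, ?_, ?_, pairing_symm_ne ?_⟩
  · rw [pairing_add_right, pairing_add_right, pairing_smul_right, h3, hr.pairing_self]; ring
  · rw [pairing_add_right, pairing_add_right, pairing_smul_right, h2, hx.pairing_self, zero_add,
      zero_add]
    exact mul_ne_zero hc (pairing_symm_ne hrx)
  · rw [pairing_add_right, pairing_add_right, pairing_smul_right, h1, hyx, zero_add,
      zero_add]
    exact mul_ne_zero hc (pairing_symm_ne hry)

/-- The isometry group is transitive on the pairs of singular vectors with a given nonzero value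
of the pairing. -/
theorem Thick.exists_isometry_fixing [Module.Finite K V] (hF : F.Thick) {r x y : V}
    (hr : F.IsSingular r) (hx : F.IsSingular x) (hy : F.IsSingular y) (hrx : F.pairing r x ≠ 0)
    (hxy : F.pairing r x = F.pairing r y) :
    ∃ k : F.isometryGroup, k.1 r = r ∧ k.1 x = y := by
  have key : ∀ u v : V, F.IsSingular u → F.IsSingular v → F.pairing r u = F.pairing r v →
      F.pairing u v ≠ 0 → ∃ k : F.isometryGroup, k.1 r = r ∧ k.1 u = v := by
    intro u v hu hv huv h
    obtain ⟨t, ht, ht'⟩ := exists_isometry_moving hu hv h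
    exact ⟨t, ht' r (pairing_symm_zero (by rw [pairing_sub_right, huv, sub_self])), ht⟩
  by_cases h : F.pairing x y = 0
  · obtain ⟨z, hz, h1, h2, h3⟩ := hF.exists_between hr hx hy hrx hxy h
    obtain ⟨s, hs, hs'⟩ := key x z hx hz h1.symm h2
    obtain ⟨t, ht, ht'⟩ := key z y hz hy (h1.trans hxy) h3
    exact ⟨t * s, by rw [isometryGroup_apply_mul, hs, ht],
      by rw [isometryGroup_apply_mul, hs', ht']⟩
  · exact key x y hx hy hxy h

/-- If `x` and `y` have the same nonzero pairing with `z`, an element of the derived subgroup moves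
`x` to `y`: it is the commutator of an isometry `k` that maps the pair `(z, x)` to `(z, y)` with an
isometry that moves `z` to `x` along `x - z`. -/
theorem Thick.exists_commutator_moving [Module.Finite K V] (hF : F.Thick) {z x y : V}
    (hz : F.IsSingular z) (hx : F.IsSingular x) (hy : F.IsSingular y) (hzx : F.pairing z x ≠ 0)
    (hxy : F.pairing z x = F.pairing z y) :
    ∃ d ∈ commutator F.isometryGroup, d.1 x = y ∧
      ∀ w, F.pairing z w = 0 → F.pairing x w = 0 → F.pairing y w = 0 → d.1 w = w := by
  obtain ⟨k, hk, hk'⟩ := hF.exists_isometry_fixing hz hx hy hzx hxy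
  obtain ⟨t, ht, ht'⟩ := exists_isometry_moving hz hx hzx
  refine ⟨k * t * k⁻¹ * t⁻¹, Subgroup.commutator_mem_commutator (Subgroup.mem_top k)
    (Subgroup.mem_top t), ?_, fun w h1 h2 h3 => ?_⟩
  · simp only [isometryGroup_apply_mul]
    rw [isometryGroup_inv_apply_eq ht, isometryGroup_inv_apply_eq hk, ht, hk']
  · simp only [isometryGroup_apply_mul]
    rw [isometryGroup_inv_apply_eq (ht' w (by rw [pairing_sub_left, h1, h2, sub_zero])),
      ht' ((k⁻¹).1 w), isometryGroup_apply_inv]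
    rw [pairing_apply_inv, map_sub, hk, hk', pairing_sub_left, h1, h3, sub_zero]

/-- If `x` and `y` have the same nonzero pairing with `r`, an element of the derived subgroup fixes
`r` and moves `x` to `y`. An isometry `t` moving `x` to `y` along `y - x` does so, and is corrected
by the inverse of a conjugate of `t` that acts trivially on `r` and `x`. -/
theorem Thick.exists_commutator_fixing [Module.Finite K V] (hF : F.Thick) (hF' : F.RankTwo)
    {r x y : V} (hr : F.IsSingular r) (hx : F.IsSingular x) (hy : F.IsSingular y)
    (hrx : F.pairing r x ≠ 0) (hxy : F.pairing r x = F.pairing r y) :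
    ∃ d ∈ commutator F.isometryGroup, d.1 r = r ∧ d.1 x = y := by
  have key : ∀ u v : V, F.IsSingular u → F.IsSingular v → F.pairing r u ≠ 0 →
      F.pairing r u = F.pairing r v →
      F.pairing u v ≠ 0 → ∃ d ∈ commutator F.isometryGroup, d.1 r = r ∧ d.1 u = v := by
    intro u v hu hv hru huv h
    have hvr : F.pairing (v - u) r = 0 :=
      pairing_symm_zero (by rw [pairing_sub_right, huv, sub_self])
    have hu0 : u ≠ 0 := by
      rintro rfl
      exact hru (F.pairing_zero_right r)
    obtain ⟨t, ht, ht'⟩ := exists_isometry_moving hu hv h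
    obtain ⟨e, he, he0, hre, hue⟩ := hF'.exists_orthogonal_pair hr hru
    obtain ⟨f, hf, hef, hrf, huf⟩ := exists_hyperbolic_partner hr hu hru he he0 hre hue
      (F.pairing u v)
    obtain ⟨k1, hk1⟩ := exists_isometry_apply_eq hu he hu0 he0
    have h1 : F.pairing e (k1.1 v) = F.pairing u v := by rw [← hk1, pairing_apply_apply]
    obtain ⟨k2, hk2, hk2'⟩ := hF.exists_isometry_fixing he (hv.apply k1) hf (h1 ▸ h)
      (h1.trans hef.symm)
    set k := k2 * k1 with hk
    have hku : k.1 u = e := by rw [hk, isometryGroup_apply_mul, hk1, hk2]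
    have hkv : k.1 v = f := by rw [hk, isometryGroup_apply_mul, hk2']
    have hfix : ∀ w, F.pairing w e = 0 → F.pairing w f = 0 →
        (t * k * t⁻¹ * k⁻¹).1 w = t.1 w := by
      intro w h2 h3
      simp only [isometryGroup_apply_mul]
      rw [isometryGroup_inv_apply_eq (ht' ((k⁻¹).1 w) _), isometryGroup_apply_inv]
      rw [pairing_apply_inv, map_sub, hku, hkv]
      exact pairing_symm_zero (by rw [pairing_sub_right, h2, h3, sub_zero])
    exact ⟨t * k * t⁻¹ * k⁻¹, Subgroup.commutator_mem_commutator (Subgroup.mem_top t)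
      (Subgroup.mem_top k), (hfix r hre hrf).trans (ht' r hvr), (hfix u hue huf).trans ht⟩
  by_cases h : F.pairing x y = 0
  · obtain ⟨z, hz, h1, h2, h3⟩ := hF.exists_between hr hx hy hrx hxy h
    obtain ⟨s, hsm, hs, hs'⟩ := key x z hx hz hrx h1.symm h2
    obtain ⟨t, htm, ht, ht'⟩ := key z y hz hy (h1 ▸ hrx) (h1.trans hxy) h3
    exact ⟨t * s, mul_mem htm hsm, by rw [isometryGroup_apply_mul, hs, ht],
      by rw [isometryGroup_apply_mul, hs', ht']⟩
  · exact key x y hx hy hrx hxy h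

/-- The derived subgroup is transitive on the points. -/
theorem Thick.exists_commutator_point [Module.Finite K V] (hF : F.Thick) (hF' : F.RankTwo)
    {x y : V} (hx : F.IsSingular x) (hy : F.IsSingular y) (hx0 : x ≠ 0) (hy0 : y ≠ 0) :
    ∃ d ∈ commutator F.isometryGroup, ∃ c : K, c ≠ 0 ∧ d.1 x = c • y := by
  have key : ∀ u v : V, F.IsSingular u → F.IsSingular v → u ≠ 0 → v ≠ 0 → F.pairing u v = 0 →
      ∃ d ∈ commutator F.isometryGroup, ∃ c : K, c ≠ 0 ∧ d.1 u = c • v := by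
    intro u v hu hv hu0 hv0 h
    obtain ⟨r, hr, h1, h2⟩ := exists_singular_not_orthogonal_pair hu hv h hu0 hv0
    have h1' := pairing_symm_ne h1
    have h2' := pairing_symm_ne h2
    obtain ⟨d, hd, -, hd'⟩ := hF.exists_commutator_fixing hF' hr hu
      (hv.smul (F.pairing r u / F.pairing r v)) h1'
      (by rw [pairing_smul_right, div_mul_cancel₀ _ h2'])
    exact ⟨d, hd, _, div_ne_zero h1' h2', hd'⟩
  by_cases h : F.pairing x y = 0
  · exact key x y hx hy hx0 hy0 h
  · obtain ⟨e, he, he0, h1, h2⟩ := hF'.exists_orthogonal_pair hx h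
    obtain ⟨d, hd, c, hc, hd'⟩ := key x e hx he hx0 he0 h1
    obtain ⟨d1, hd1, c1, hc1, hd1'⟩ := key e y he hy he0 hy0 (pairing_symm_zero h2)
    refine ⟨d1 * d, mul_mem hd1 hd, c * c1, mul_ne_zero hc hc1, ?_⟩
    rw [isometryGroup_apply_mul, hd', map_smul, hd1', smul_smul]

/-- The derived subgroup is transitive on the ordered pairs of non-collinear points. -/
theorem Thick.exists_commutator_not_orthogonal [Module.Finite K V] (hF : F.Thick)
    (hF' : F.RankTwo) {x y x' y' : V} (hx : F.IsSingular x) (hy : F.IsSingular y)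
    (hx' : F.IsSingular x') (hy' : F.IsSingular y') (h : F.pairing x y ≠ 0)
    (h' : F.pairing x' y' ≠ 0) :
    ∃ d ∈ commutator F.isometryGroup,
      (∃ c : K, c ≠ 0 ∧ d.1 x = c • x') ∧ ∃ c : K, c ≠ 0 ∧ d.1 y = c • y' := by
  have hx0 : x ≠ 0 := by
    rintro rfl
    exact pairing_symm_ne h (F.pairing_zero_right y)
  have hx0' : x' ≠ 0 := by
    rintro rfl
    exact pairing_symm_ne h' (F.pairing_zero_right y')
  obtain ⟨d, hd, c, hc, hdx⟩ := hF.exists_commutator_point hF' hx hx' hx0 hx0'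
  have h1 : F.pairing (d.1 x) (d.1 y) ≠ 0 := by rwa [pairing_apply_apply]
  have h2 : F.pairing (d.1 x) y' ≠ 0 := by
    rw [hdx, pairing_smul_left]
    exact mul_ne_zero (F.conj_ne_zero hc) h'
  obtain ⟨d1, hd1, h3, h4⟩ := hF.exists_commutator_fixing hF' (hx.apply d) (hy.apply d)
    (hy'.smul (F.pairing (d.1 x) (d.1 y) / F.pairing (d.1 x) y')) h1
    (by rw [pairing_smul_right, div_mul_cancel₀ _ h2])
  exact ⟨d1 * d, mul_mem hd1 hd, ⟨c, hc, by rw [isometryGroup_apply_mul, h3, hdx]⟩,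
    _, div_ne_zero h1 h2, by rw [isometryGroup_apply_mul, h4]⟩

/-- The derived subgroup is transitive on the ordered pairs of distinct collinear points. -/
theorem Thick.exists_commutator_orthogonal [Module.Finite K V] (hF : F.Thick)
    (hF' : F.RankTwo) {x y x' y' : V} (hx : F.IsSingular x) (hy : F.IsSingular y)
    (hx' : F.IsSingular x') (hy' : F.IsSingular y') (hx0 : x ≠ 0) (hx0' : x' ≠ 0)
    (h : F.pairing x y = 0) (h' : F.pairing x' y' = 0) (hind : ∀ c : K, y ≠ c • x)
    (hind' : ∀ c : K, y' ≠ c • x') :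
    ∃ d ∈ commutator F.isometryGroup,
      (∃ c : K, c ≠ 0 ∧ d.1 x = c • x') ∧ ∃ c : K, c ≠ 0 ∧ d.1 y = c • y' := by
  obtain ⟨d, hd, c, hc, hdx⟩ := hF.exists_commutator_point hF' hx hx' hx0 hx0'
  have h1 : F.pairing (d.1 x) (d.1 y) = 0 := by rwa [pairing_apply_apply]
  have h2 : F.pairing (d.1 x) y' = 0 := by rw [hdx, pairing_smul_left, h', mul_zero]
  have hind1 : ∀ a : K, d.1 y ≠ a • d.1 x := fun a ha =>
    hind a (d.1.injective (by rw [ha, map_smul]))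
  have hind2 : ∀ a : K, y' ≠ a • d.1 x := fun a ha => by
    rw [hdx, smul_smul] at ha
    exact hind' _ ha
  obtain ⟨z, hz, hxz, hyz, hyz'⟩ : ∃ z, F.IsSingular z ∧ F.pairing (d.1 x) z = 0 ∧
      F.pairing (d.1 y) z ≠ 0 ∧ F.pairing y' z ≠ 0 := by
    by_cases h3 : F.pairing (d.1 y) y' = 0
    · exact exists_singular_not_orthogonal (hx.apply d) (hy.apply d) hy' h1 h2 h3 hind1 hind2
    · obtain ⟨m, a, ha, h4, h5, h6, h7⟩ :=
        hF _ _ _ (hx.apply d) (hy.apply d) hy' h1 h2 h3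
      refine ⟨_, h7, ?_, ?_, ?_⟩
      · rw [pairing_add_right, pairing_add_right, pairing_smul_right, h1, h4, h2]; ring
      · rw [pairing_add_right, pairing_add_right, pairing_smul_right, (hy.apply d).pairing_self,
          h5, zero_add, zero_add]
        exact mul_ne_zero ha h3
      · rw [pairing_add_right, pairing_add_right, pairing_smul_right, hy'.pairing_self,
          h6, mul_zero, add_zero, add_zero]
        exact pairing_symm_ne h3
  have h3 := pairing_symm_ne hyz
  have h4 := pairing_symm_ne hyz'
  obtain ⟨d1, hd1, h5, h6⟩ := hF.exists_commutator_moving hz (hy.apply d)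
    (hy'.smul (F.pairing z (d.1 y) / F.pairing z y')) h3
    (by rw [pairing_smul_right, div_mul_cancel₀ _ h4])
  refine ⟨d1 * d, mul_mem hd1 hd, ⟨c, hc, ?_⟩, _, div_ne_zero h3 h4,
    by rw [isometryGroup_apply_mul, h5]⟩
  rw [isometryGroup_apply_mul, h6 (d.1 x) (pairing_symm_zero hxz) (pairing_symm_zero h1), hdx]
  rw [pairing_smul_left, pairing_symm_zero h2, mul_zero]

/-! ### Points and maximal totally singular subspaces -/

/-- A vector spanning the point `p`. -/
noncomputable def Point.vec (p : F.Point) : V := p.1.rep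

theorem Point.vec_ne_zero (p : F.Point) : p.vec ≠ 0 := p.1.rep_nonzero

theorem Point.submodule_eq (p : F.Point) : p.submodule = Submodule.span K {p.vec} :=
  p.1.submodule_eq

theorem Point.submodule_le_iff {p : F.Point} {W : Submodule K V} :
    p.submodule ≤ W ↔ p.vec ∈ W := by
  rw [p.submodule_eq, Submodule.span_singleton_le_iff_mem]

theorem Point.isSingular (p : F.Point) : F.IsSingular p.vec :=
  (isTotallySingular_iff.1 p.2).1 _ (Point.submodule_le_iff.1 le_rfl)

theorem IsTotallySingular.sup_span {W : Submodule K V} (hW : F.IsTotallySingular W) {x : V}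
    (hx : F.IsSingular x) (h : ∀ w ∈ W, F.pairing w x = 0) :
    F.IsTotallySingular (W ⊔ Submodule.span K {x}) := by
  rw [isTotallySingular_iff] at hW ⊢
  refine ⟨fun u hu => ?_, fun u hu v hv => ?_⟩
  · obtain ⟨w, hw, _, h', rfl⟩ := Submodule.mem_sup.1 hu
    obtain ⟨c, rfl⟩ := Submodule.mem_span_singleton.1 h'
    exact (hW.1 w hw).add (hx.smul c) (by rw [pairing_smul_right, h w hw, mul_zero])
  · obtain ⟨w, hw, _, h', rfl⟩ := Submodule.mem_sup.1 hu
    obtain ⟨c, rfl⟩ := Submodule.mem_span_singleton.1 h'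
    obtain ⟨w', hw', _, h'', rfl⟩ := Submodule.mem_sup.1 hv
    obtain ⟨c', rfl⟩ := Submodule.mem_span_singleton.1 h''
    rw [pairing_add_right, pairing_add_left, pairing_add_left, pairing_smul_left,
      pairing_smul_left, pairing_smul_right, pairing_smul_right, hW.2 w hw w' hw', h w hw,
      pairing_symm_zero (h w' hw'), hx.pairing_self]
    ring

theorem isTotallySingular_span {S : Set V} (hS : ∀ x ∈ S, F.IsSingular x)
    (h : ∀ x ∈ S, ∀ y ∈ S, F.pairing x y = 0) : F.IsTotallySingular (Submodule.span K S) := by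
  have h1 : ∀ x ∈ S, ∀ y ∈ Submodule.span K S, F.pairing x y = 0 := by
    intro x hx
    have : Submodule.span K S ≤ LinearMap.ker (F.pairingLin x) :=
      Submodule.span_le.2 fun y hy => h x hx y hy
    exact fun y hy => this hy
  have h2 : ∀ x ∈ Submodule.span K S, ∀ y ∈ Submodule.span K S, F.pairing x y = 0 := by
    intro x hx
    have : Submodule.span K S ≤ LinearMap.ker (F.pairingLin x) :=
      Submodule.span_le.2 fun y hy => pairing_symm_zero (h1 y hy x hx)
    exact fun y hy => this hy
  refine isTotallySingular_iff.2 ⟨fun x hx => ?_, h2⟩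
  induction hx using Submodule.span_induction with
  | mem x hx => exact hS x hx
  | zero => cases F <;> simp [IsSingular]
  | add x y hx hy h3 h4 => exact h3.add h4 (h2 x hx y hy)
  | smul c x hx h3 => exact h3.smul c

/-- The point spanned by a nonzero singular vector. -/
def Point.mk (x : V) (hx : F.IsSingular x) (h0 : x ≠ 0) : F.Point :=
  ⟨Projectivization.mk K x h0, by
    rw [Projectivization.submodule_mk]
    refine isTotallySingular_span (by simpa using hx) ?_
    simpa using hx.pairing_self⟩

theorem Point.submodule_mk (x : V) (hx : F.IsSingular x) (h0 : x ≠ 0) :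
    (Point.mk x hx h0).submodule = Submodule.span K {x} :=
  Projectivization.submodule_mk _ _

theorem Point.mk_le_iff {x : V} {hx : F.IsSingular x} {h0 : x ≠ 0} {W : Submodule K V} :
    (Point.mk x hx h0).submodule ≤ W ↔ x ∈ W := by
  rw [Point.submodule_mk, Submodule.span_singleton_le_iff_mem]

theorem Point.vec_mk_mem_iff {x : V} {hx : F.IsSingular x} {h0 : x ≠ 0} {W : Submodule K V} :
    (Point.mk x hx h0).vec ∈ W ↔ x ∈ W := by
  rw [← Point.submodule_le_iff, Point.mk_le_iff]

theorem Point.submodule_inj {p q : F.Point} (h : p.submodule = q.submodule) : p = q :=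
  Subtype.ext (Projectivization.submodule_injective h)

theorem Point.eq_of_vec_eq_smul {p q : F.Point} {c : K} (h : p.vec = c • q.vec) : p = q := by
  have hc : c ≠ 0 := by
    rintro rfl
    exact p.vec_ne_zero (by simpa using h)
  refine Point.submodule_inj ?_
  rw [p.submodule_eq, q.submodule_eq, h, Submodule.span_singleton_smul_eq hc.isUnit]

theorem Point.vec_ne_smul {p q : F.Point} (h : p ≠ q) (c : K) : p.vec ≠ c • q.vec :=
  fun h' => h (Point.eq_of_vec_eq_smul h')

theorem Point.exists_vec_mk (x : V) (hx : F.IsSingular x) (h0 : x ≠ 0) :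
    ∃ c : K, c ≠ 0 ∧ (Point.mk x hx h0).vec = c • x := by
  have h : (Point.mk x hx h0).vec ∈ Submodule.span K {x} := by
    rw [← Point.submodule_le_iff, Point.submodule_mk]
  obtain ⟨c, hc⟩ := Submodule.mem_span_singleton.1 h
  refine ⟨c, ?_, hc.symm⟩
  rintro rfl
  exact Point.vec_ne_zero _ (by rw [← hc, zero_smul])

theorem collinear_iff {p q : F.Point} : F.Collinear p q ↔ F.pairing p.vec q.vec = 0 := by
  refine ⟨fun h => (isTotallySingular_iff.1 h).2 _ ?_ _ ?_, fun h => ?_⟩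
  · exact Point.submodule_le_iff.1 le_sup_left
  · exact Point.submodule_le_iff.1 le_sup_right
  · rw [Collinear, q.submodule_eq]
    refine IsTotallySingular.sup_span p.2 q.isSingular fun w hw => ?_
    change w ∈ p.submodule at hw
    rw [p.submodule_eq] at hw
    obtain ⟨c, rfl⟩ := Submodule.mem_span_singleton.1 hw
    rw [pairing_smul_left, h, mul_zero]

theorem collinear_self (p : F.Point) : F.Collinear p p := collinear_iff.2 p.isSingular.pairing_self

theorem Collinear.symm {p q : F.Point} (h : F.Collinear p q) : F.Collinear q p :=
  collinear_iff.2 (pairing_symm_zero (collinear_iff.1 h))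

theorem exists_not_collinear (p : F.Point) : ∃ q : F.Point, ¬ F.Collinear p q := by
  obtain ⟨y, hy⟩ := p.isSingular.exists_pairing_ne p.vec_ne_zero
  obtain ⟨c, hc⟩ := p.isSingular.exists_singular_add_smul hy
  have h : F.pairing p.vec (y + c • p.vec) ≠ 0 := by
    rwa [pairing_add_right, pairing_smul_right, p.isSingular.pairing_self, mul_zero, add_zero]
  have h0 : y + c • p.vec ≠ 0 := fun h' => h (by rw [h', pairing_zero_right])
  obtain ⟨a, ha, hv⟩ := Point.exists_vec_mk _ hc h0
  refine ⟨Point.mk _ hc h0, fun h' => ?_⟩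
  rw [collinear_iff, hv, pairing_smul_right] at h'
  exact mul_ne_zero ha h h'

theorem IsTotallySingular.collinear {W : Submodule K V} (hW : F.IsTotallySingular W)
    {p q : F.Point} (hp : p.submodule ≤ W) (hq : q.submodule ≤ W) : F.Collinear p q :=
  collinear_iff.2 ((isTotallySingular_iff.1 hW).2 _ (Point.submodule_le_iff.1 hp) _
    (Point.submodule_le_iff.1 hq))

theorem IsMaximalSingular.mem {W : Submodule K V} (hW : F.IsMaximalSingular W) {x : V}
    (hx : F.IsSingular x) (h : ∀ w ∈ W, F.pairing w x = 0) : x ∈ W :=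
  hW.2 (IsTotallySingular.sup_span hW.1 hx h) le_sup_left
    (Submodule.mem_sup_right (Submodule.mem_span_singleton_self x))

theorem exists_isMaximalSingular_ge [Module.Finite K V] {W : Submodule K V}
    (hW : F.IsTotallySingular W) : ∃ M, F.IsMaximalSingular M ∧ W ≤ M := by
  obtain ⟨M, hWM, hM⟩ := exists_maximal_ge_of_wellFoundedGT F.IsTotallySingular W hW
  exact ⟨M, hM, hWM⟩

/-- Pairwise collinear points lie in a common maximal totally singular subspace. -/
theorem exists_isMaximalSingular_of_pairwise [Module.Finite K V] {C : Set F.Point}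
    (hC : ∀ p ∈ C, ∀ q ∈ C, F.Collinear p q) :
    ∃ M, F.IsMaximalSingular M ∧ ∀ p ∈ C, p.submodule ≤ M := by
  obtain ⟨M, hM, h⟩ := exists_isMaximalSingular_ge
    (isTotallySingular_span (F := F) (S := Point.vec '' C) (by
      rintro _ ⟨p, -, rfl⟩
      exact p.isSingular) (by
      rintro _ ⟨p, hp, rfl⟩ _ ⟨q, hq, rfl⟩
      exact collinear_iff.1 (hC p hp q hq)))
  exact ⟨M, hM, fun p hp => Point.submodule_le_iff.2
    (h (Submodule.subset_span (Set.mem_image_of_mem _ hp)))⟩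

theorem Collinear.exists_isMaximalSingular [Module.Finite K V] {p q : F.Point}
    (h : F.Collinear p q) :
    ∃ M, F.IsMaximalSingular M ∧ p.submodule ≤ M ∧ q.submodule ≤ M := by
  obtain ⟨M, hM, hM'⟩ := exists_isMaximalSingular_ge h
  exact ⟨M, hM, le_sup_left.trans hM', le_sup_right.trans hM'⟩

/-- If `W` had larger dimension than the maximal totally singular subspace `U`, then some vector
of `W` outside `U` would be orthogonal to `U`. -/
theorem IsMaximalSingular.finrank_le [Module.Finite K V] {U W : Submodule K V}
    (hU : F.IsMaximalSingular U) (hW : F.IsTotallySingular W) :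
    Module.finrank K W ≤ Module.finrank K U := by
  have hU1 := isTotallySingular_iff.1 hU.1
  have hW1 := isTotallySingular_iff.1 hW
  -- `C` is a complement of `U ∩ W` in `U`, and `b` a basis of it.
  obtain ⟨C, hC⟩ := Submodule.exists_isCompl ((U ⊓ W).comap U.subtype)
  let b := Module.finBasis K C
  let φ : W →ₗ[K] (Fin (Module.finrank K C) → K) :=
    LinearMap.pi fun i => (F.pairingLin ((b i : U) : V)).comp W.subtype
  have hker : LinearMap.ker φ ≤ (U ⊓ W).comap W.subtype := by
    intro w hw
    refine ⟨hU.mem (hW1.1 w w.2) fun u hu => pairing_symm_zero ?_, w.2⟩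
    have hwb : ∀ i, F.pairing (w : V) ((b i : U) : V) = 0 := fun i =>
      pairing_symm_zero (congrFun (LinearMap.mem_ker.1 hw) i)
    have hCw : ∀ c : C, F.pairing (w : V) ((c : U) : V) = 0 := by
      have : ((F.pairingLin (w : V)).comp (U.subtype.comp C.subtype)) = 0 := b.ext hwb
      exact fun c => LinearMap.congr_fun this c
    have htop : (⟨u, hu⟩ : U) ∈ (U ⊓ W).comap U.subtype ⊔ C := by
      rw [hC.sup_eq_top]; trivial
    obtain ⟨x, hx, c, hc, hxc⟩ := Submodule.mem_sup.1 htop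
    have huxc : u = (x : V) + (c : V) := by
      have := congrArg Subtype.val hxc
      simpa using this.symm
    change F.pairing (w : V) u = 0
    rw [huxc, pairing_add_right, hW1.2 w w.2 x hx.2, hCw ⟨c, hc⟩, add_zero]
  have h1 := φ.finrank_range_add_finrank_ker
  have h2 : Module.finrank K (LinearMap.range φ) ≤ Module.finrank K C := by
    simpa using Submodule.finrank_le (LinearMap.range φ)
  have h3 : Module.finrank K (LinearMap.ker φ) ≤ Module.finrank K ↥(U ⊓ W) :=
    (Submodule.finrank_mono hker).trans
      (Submodule.comapSubtypeEquivOfLe (inf_le_right : U ⊓ W ≤ W)).finrank_eq.le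
  have h4 := Submodule.finrank_add_eq_of_isCompl hC
  have h5 := (Submodule.comapSubtypeEquivOfLe (inf_le_left : U ⊓ W ≤ U)).finrank_eq
  omega

theorem IsMaximalSingular.finrank_eq [Module.Finite K V] {U W : Submodule K V}
    (hU : F.IsMaximalSingular U) (hW : F.IsMaximalSingular W) :
    Module.finrank K U = Module.finrank K W :=
  le_antisymm (hW.finrank_le hU.1) (hU.finrank_le hW.1)

theorem RankTwo.two_le_finrank [Module.Finite K V] (hF : F.RankTwo) {W : Submodule K V}
    (hW : F.IsMaximalSingular W) : 2 ≤ Module.finrank K W := by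
  obtain ⟨U, hU, h⟩ := hF
  exact h.trans (hW.finrank_le hU)

variable (F) in
/-- The set of points of a subspace. -/
def pointsOf (W : Submodule K V) : Set F.Point := {p | p.submodule ≤ W}

instance [Finite K] [Module.Finite K V] : Finite F.Point := by
  have : Finite V := Module.finite_of_finite K
  have : Finite (ℙ K V) := Quotient.finite _
  exact Subtype.finite

theorem IsMaximalSingular.ncard_pointsOf_le [Finite K] [Module.Finite K V] {U W : Submodule K V}
    (hU : F.IsMaximalSingular U) (hW : F.IsMaximalSingular W) :
    (F.pointsOf U).ncard ≤ (F.pointsOf W).ncard := by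
  let e : U ≃ₗ[K] W := LinearEquiv.ofFinrankEq _ _ (hU.finrank_eq hW)
  have hmem : ∀ p ∈ F.pointsOf U, p.vec ∈ U := fun p hp => Point.submodule_le_iff.1 hp
  have hs : ∀ w : W, F.IsSingular (w : V) := fun w => (isTotallySingular_iff.1 hW.1).1 w w.2
  have h0 : ∀ p (hp : p ∈ F.pointsOf U), (e ⟨p.vec, hmem p hp⟩ : V) ≠ 0 := by
    intro p hp h
    have : (⟨p.vec, hmem p hp⟩ : U) = 0 := e.map_eq_zero_iff.1 (Subtype.ext h)
    exact p.vec_ne_zero (congrArg Subtype.val this)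
  refine Set.ncard_le_ncard_of_injOn
    (fun p => open Classical in if hp : p ∈ F.pointsOf U then
      Point.mk (e ⟨p.vec, hmem p hp⟩ : V) (hs _) (h0 p hp) else p) ?_ ?_ (Set.toFinite _)
  · intro p hp
    simp only [hp, dif_pos]
    exact Point.mk_le_iff.2 (e _).2
  · intro p hp q hq hpq
    simp only [hp, hq, dif_pos] at hpq
    have h1 := congrArg Point.submodule hpq
    rw [Point.submodule_mk, Point.submodule_mk] at h1
    have h2 : (e ⟨p.vec, hmem p hp⟩ : V) ∈ Submodule.span K {(e ⟨q.vec, hmem q hq⟩ : V)} :=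
      h1 ▸ Submodule.mem_span_singleton_self _
    obtain ⟨c, hc⟩ := Submodule.mem_span_singleton.1 h2
    have h3 : e (c • ⟨q.vec, hmem q hq⟩) = e ⟨p.vec, hmem p hp⟩ := by
      rw [map_smul]; exact Subtype.ext hc
    exact Point.eq_of_vec_eq_smul (congrArg Subtype.val (e.injective h3)).symm

theorem IsMaximalSingular.ncard_pointsOf_eq [Finite K] [Module.Finite K V] {U W : Submodule K V}
    (hU : F.IsMaximalSingular U) (hW : F.IsMaximalSingular W) :
    (F.pointsOf U).ncard = (F.pointsOf W).ncard :=
  le_antisymm (hU.ncard_pointsOf_le hW) (hW.ncard_pointsOf_le hU)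

theorem RankTwo.exists_collinear_ne [Module.Finite K V] (hF : F.RankTwo) (p : F.Point) :
    ∃ q : F.Point, q ≠ p ∧ F.Collinear p q := by
  obtain ⟨y, hy, h, hne⟩ := hF.exists_orthogonal p.isSingular p.vec_ne_zero
  have h0 : y ≠ 0 := by simpa using hne 0
  obtain ⟨a, ha, hv⟩ := Point.exists_vec_mk _ hy h0
  refine ⟨Point.mk y hy h0, fun h' => ?_, ?_⟩
  · have h1 : y ∈ Submodule.span K {p.vec} := by
      rw [← p.submodule_eq, ← Point.mk_le_iff (hx := hy) (h0 := h0), h']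
    obtain ⟨c, hc⟩ := Submodule.mem_span_singleton.1 h1
    exact hne c hc.symm
  · rw [collinear_iff, hv, pairing_smul_right, h, mul_zero]

theorem RankTwo.nonempty_point (hF : F.RankTwo) : Nonempty F.Point := by
  obtain ⟨W, hW, h⟩ := hF
  have : Module.Finite K W := Module.finite_of_finrank_pos (by omega)
  obtain ⟨u, hu⟩ := (Module.finrank_pos_iff_exists_ne_zero (R := K) (M := W)).1 (by omega)
  exact ⟨Point.mk (u : V) ((isTotallySingular_iff.1 hW).1 u u.2) (by simpa using hu)⟩

end ClassicalForm

namespace ClassicalForm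

variable {K V : Type*} [Field K] [AddCommGroup V] [Module K V]

/-! ### The polar spaces that are not thick -/

theorem thick_symplectic (B : LinearMap.BilinForm K V) (alt : B.IsAlt) (nd : B.Nondegenerate) :
    (symplectic B alt nd).Thick := fun _ _ _ _ _ _ _ _ _ =>
  ⟨0, 1, one_ne_zero, pairing_zero_right _ _, pairing_zero_right _ _, pairing_zero_right _ _,
    trivial⟩

theorem thick_unitary (σ : K →+* K) (invol : ∀ a, σ (σ a) = a) (nontriv : σ ≠ RingHom.id K)
    (H : V →ₛₗ[σ] V →ₗ[K] K) (herm : H.IsSymm) (nd : H.Nondegenerate) :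
    (unitary σ invol nontriv H herm nd).Thick := by
  intro p y y' _ hy hy' _ _ h
  -- The scalar `c` is chosen so that `c * H y y'` is the nonzero element `a - σ a` of trace zero.
  obtain ⟨a, ha⟩ : ∃ a, a - σ a ≠ 0 := by
    by_contra! h'
    exact nontriv (RingHom.ext fun a => (sub_eq_zero.1 (h' a)).symm)
  refine ⟨0, (a - σ a) / H y y', div_ne_zero ha h, pairing_zero_right _ _, pairing_zero_right _ _,
    pairing_zero_right _ _, ?_⟩
  simp only [IsSingular, pairing] at *
  have h1 : σ (H y y') = H y' y := herm.eq y y'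
  have h2 : H y' y ≠ 0 := by rw [← h1]; simpa using h
  simp only [add_zero, map_add, LinearMap.add_apply, map_smul, LinearMap.map_smulₛₗ,
    LinearMap.smul_apply, smul_eq_mul, map_div₀, map_sub, invol, hy, hy', h1]
  field_simp
  ring

theorem pairing_orthogonal (Q : QuadraticForm K V) (nd : Q.Nondegenerate) (x y : V) :
    (orthogonal Q nd).pairing x y = Q (x + y) - Q x - Q y := rfl

/-- A quadric that is not thick is the hyperbolic quadric of a four-dimensional space: otherwise
`⟨p, y, y'⟩ᗮ` contains a nonsingular vector. -/
theorem exists_coordinates_of_not_thick [Module.Finite K V] (Q : QuadraticForm K V)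
    (nd : Q.Nondegenerate) (hF' : (orthogonal Q nd).RankTwo) (h : ¬ (orthogonal Q nd).Thick) :
    ∃ e : V ≃ₗ[K] (Fin 4 → K), ∀ v, Q v = e v 0 * e v 1 + e v 2 * e v 3 := by
  set F := orthogonal Q nd
  have hsymm : ∀ x y, F.pairing x y = F.pairing y x := fun x y => QuadraticMap.polar_comm Q x y
  simp only [Thick, not_forall] at h
  obtain ⟨p, y, y', hp, hy, hy', hpy, hpy', hyy', h⟩ := h
  have hsing : ∀ m, F.pairing p m = 0 → F.pairing y m = 0 → F.pairing y' m = 0 → Q m = 0 := by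
    intro m h1 h2 h3
    by_contra hm
    refine h ⟨m, -Q m / F.pairing y y', div_ne_zero (neg_ne_zero.2 hm) hyy', h1, h2, h3, ?_⟩
    have h4 : F.pairing (y + m) ((-Q m / F.pairing y y') • y') = -Q m := by
      rw [pairing_smul_right, pairing_add_left, hsymm m y', h3, add_zero, div_mul_cancel₀ _ hyy']
    have h5 : Q y = 0 := hy
    have h6 : Q ((-Q m / F.pairing y y') • y') = 0 := hy'.smul _
    rw [pairing_orthogonal, pairing_orthogonal] at *
    change Q _ = 0
    linear_combination h4 + h2 + h5 + h6
  have hp0 : p ≠ 0 := by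
    rintro rfl
    obtain ⟨e, he, he0, hye, hye'⟩ := hF'.exists_orthogonal_pair hy hyy'
    obtain ⟨f, hf, hef, hyf, hyf'⟩ := exists_hyperbolic_partner hy hy' hyy' he he0 hye hye' 1
    have h1 := hsing (e + f) (by simpa using F.pairing_smul_left 0 0 (e + f))
      (by rw [pairing_add_right, hye, hyf, add_zero])
      (by rw [pairing_add_right, hye', hyf', add_zero])
    have he' : Q e = 0 := he
    have hf' : Q f = 0 := hf
    rw [pairing_orthogonal, h1, he', hf'] at hef
    simp at hef
  obtain ⟨p', hs', hpp', hyp', hyp''⟩ := exists_hyperbolic_partner hy hy' hyy' hp hp0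
    (pairing_symm_zero hpy) (pairing_symm_zero hpy') 1
  -- The hyperbolic pairs `(p, p')` and `(y, z)` form the coordinate frame.
  set z := (F.pairing y y')⁻¹ • y' with hz
  have hsz : F.IsSingular z := hy'.smul _
  have hyz : F.pairing y z = 1 := by rw [hz, pairing_smul_right, inv_mul_cancel₀ hyy']
  have hpz : F.pairing p z = 0 := by rw [hz, pairing_smul_right, hpy', mul_zero]
  have hpz' : F.pairing p' z = 0 := by
    rw [hz, pairing_smul_right, hsymm p', hyp'', mul_zero]
  have hz' : ∀ m, F.pairing z m = 0 → F.pairing y' m = 0 := by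
    intro m hm
    rw [hsymm, hz, pairing_smul_right] at hm
    rw [hsymm]
    exact (mul_eq_zero.1 hm).resolve_left (inv_ne_zero hyy')
  let φ : V →ₗ[K] (Fin 4 → K) :=
    LinearMap.pi ![F.pairingLin p', F.pairingLin p, F.pairingLin z, F.pairingLin y]
  let ψ : (Fin 4 → K) → V := fun c => c 0 • p + c 1 • p' + c 2 • y + c 3 • z
  have hpp := hp.pairing_self
  have hyy := hy.pairing_self
  have hpp2 := hs'.pairing_self
  have hzz := hsz.pairing_self
  have hφψ : ∀ c, φ (ψ c) = c := by
    intro c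
    ext i
    fin_cases i <;>
      simp [φ, ψ, pairing_add_right, pairing_smul_right, hpp, hpp2, hyy, hzz, hpy, hpz, hpp', hyp',
        hyz, hpz', hsymm p' p, hsymm z p, hsymm z p', hsymm z y, hsymm p' y, hsymm y p]
  have hker : ∀ v, φ v = 0 → F.pairing p' v = 0 ∧ F.pairing p v = 0 ∧ F.pairing z v = 0 ∧
      F.pairing y v = 0 := fun v hv =>
    ⟨congrFun hv 0, congrFun hv 1, congrFun hv 2, congrFun hv 3⟩
  have hQ : ∀ v, φ v = 0 → Q v = 0 := fun v hv =>
    hsing v (hker v hv).2.1 (hker v hv).2.2.2 (hz' v (hker v hv).2.2.1)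
  have hinj : Function.Injective φ := by
    rw [injective_iff_map_eq_zero]
    intro v hv
    have hvs : F.IsSingular v := hQ v hv
    refine hvs.eq_zero fun w => ?_
    -- The component `w'` of `w` orthogonal to the frame is orthogonal to `v`, as all vectors
    -- orthogonal to the frame are singular.
    obtain ⟨w', hw'⟩ : ∃ w', w' = w - ψ (φ w) := ⟨_, rfl⟩
    have h0 : φ w' = 0 := by rw [hw', map_sub, hφψ, sub_self]
    have h1 : F.pairing v w' = 0 := by
      rw [pairing_orthogonal, hQ v hv, hQ w' h0, hQ (v + w') (by rw [map_add, hv, h0, add_zero])]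
      ring
    obtain ⟨k1, k2, k3, k4⟩ := hker v hv
    have h2 : F.pairing v (ψ (φ w)) = 0 := by
      rw [hsymm] at k1 k2 k3 k4
      simp only [ψ, pairing_add_right, pairing_smul_right, k1, k2, k3, k4]
      ring
    have h3 : w = w' + ψ (φ w) := by rw [hw', sub_add_cancel]
    rw [h3, pairing_add_right, h1, h2, add_zero]
  refine ⟨LinearEquiv.ofBijective φ ⟨hinj, fun c => ⟨ψ c, hφψ c⟩⟩, fun v => ?_⟩
  change Q v = φ v 0 * φ v 1 + φ v 2 * φ v 3
  obtain ⟨c, hc⟩ : ∃ c, c = φ v := ⟨_, rfl⟩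
  have hv : v = ψ c := hinj (by rw [hφψ, hc])
  rw [← hc, hv]
  have e1 : Q p = 0 := hp
  have e2 : Q p' = 0 := hs'
  have e3 : Q y = 0 := hy
  have e4 : Q z = 0 := hsz
  have e5 : QuadraticMap.polar Q p p' = 1 := hpp'
  have e6 : QuadraticMap.polar Q p y = 0 := hpy
  have e7 : QuadraticMap.polar Q p z = 0 := hpz
  have e8 : QuadraticMap.polar Q p' y = 0 := (hsymm _ _).trans hyp'
  have e9 : QuadraticMap.polar Q p' z = 0 := hpz'
  have e10 : QuadraticMap.polar Q y z = 1 := hyz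
  simp only [ψ, QuadraticMap.map_add Q, QuadraticMap.map_smul, QuadraticMap.polar_add_left,
    QuadraticMap.polar_smul_left, QuadraticMap.polar_smul_right, e1, e2, e3, e4, e5, e6, e7, e8,
    e9, e10, smul_eq_mul]
  ring

section Hyperbolic

variable {Q : QuadraticForm K V} {nd : Q.Nondegenerate} {e : V ≃ₗ[K] (Fin 4 → K)}

theorem pairing_coordinates (he : ∀ v, Q v = e v 0 * e v 1 + e v 2 * e v 3) (u v : V) :
    (orthogonal Q nd).pairing u v =
      e u 0 * e v 1 + e v 0 * e u 1 + e u 2 * e v 3 + e v 2 * e u 3 := by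
  rw [pairing_orthogonal, he, he, he, map_add]
  simp only [Pi.add_apply]
  ring

/-- The intersection of the hyperbolic quadric with the hyperplane orthogonal to a nonsingular
vector is an ovoid. -/
theorem exists_isOvoid_of_coordinates [Module.Finite K V]
    (he : ∀ v, Q v = e v 0 * e v 1 + e v 2 * e v 3) (hF' : (orthogonal Q nd).RankTwo) :
    ∃ O : Set (orthogonal Q nd).Point, (orthogonal Q nd).IsOvoid O := by
  let φ : V →ₗ[K] K :=
    ((LinearMap.proj 2 : (Fin 4 → K) →ₗ[K] K) - LinearMap.proj 3).comp (e : V →ₗ[K] (Fin 4 → K))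
  have hφ : ∀ v, φ v = e v 2 - e v 3 := fun v => rfl
  refine ⟨{p | φ p.vec = 0}, fun W hW => ?_⟩
  have hW1 := isTotallySingular_iff.1 hW.1
  obtain ⟨w, hw, hw0⟩ : ∃ w : W, φ w = 0 ∧ w ≠ 0 := by
    have h1 := (φ.comp W.subtype).finrank_range_add_finrank_ker
    have h2 : Module.finrank K (LinearMap.range (φ.comp W.subtype)) ≤ 1 := by
      simpa using Submodule.finrank_le (LinearMap.range (φ.comp W.subtype))
    have h3 := hF'.two_le_finrank hW
    obtain ⟨w, hw⟩ := (Module.finrank_pos_iff_exists_ne_zero (R := K)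
      (M := LinearMap.ker (φ.comp W.subtype))).1 (by omega)
    exact ⟨w, w.2, by simpa using hw⟩
  have hw0' : (w : V) ≠ 0 := by simpa using hw0
  refine ⟨Point.mk (w : V) (hW1.1 w w.2) hw0', ⟨?_, Point.mk_le_iff.2 w.2⟩, ?_⟩
  · exact (Point.vec_mk_mem_iff (W := LinearMap.ker φ)).2 hw
  rintro q ⟨hq, hqW⟩
  have hqW' := Point.submodule_le_iff.1 hqW
  -- The singular vectors orthogonal to each other in this hyperplane are proportional, since the
  -- squares of the minors of their coordinates vanish.
  have h1 : Q q.vec = 0 := q.isSingular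
  have h2 : Q w = 0 := hW1.1 w w.2
  have h3 := hW1.2 q.vec hqW' w w.2
  have h4 : e q.vec 3 = e q.vec 2 := (sub_eq_zero.1 ((hφ _).symm.trans hq)).symm
  have h5 : e (w : V) 3 = e (w : V) 2 := (sub_eq_zero.1 ((hφ _).symm.trans hw)).symm
  rw [pairing_coordinates he] at h3
  rw [he] at h1 h2
  rw [h4] at h1 h3
  rw [h5] at h2 h3
  have hex : ∃ c : K, q.vec = c • (w : V) := by
    have hext : ∀ c : K, e q.vec 0 = c * e (w : V) 0 → e q.vec 1 = c * e (w : V) 1 →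
        e q.vec 2 = c * e (w : V) 2 → q.vec = c • (w : V) := by
      intro c k0 k1 k2
      apply e.injective
      rw [map_smul]
      ext i
      fin_cases i
      · exact k0
      · exact k1
      · exact k2
      · exact h4.trans (k2.trans (congrArg _ h5.symm))
    have hew : e (w : V) ≠ 0 := by simpa using hw0
    generalize e q.vec = u at *
    generalize e (w : V) = v at *
    have m1 : u 0 * v 2 - v 0 * u 2 = 0 := by
      apply pow_eq_zero_iff (two_ne_zero) |>.1
      linear_combination (v 0) ^ 2 * h1 + (u 0) ^ 2 * h2 - u 0 * v 0 * h3
    have m2 : u 1 * v 2 - v 1 * u 2 = 0 := by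
      apply pow_eq_zero_iff (two_ne_zero) |>.1
      linear_combination (v 1) ^ 2 * h1 + (u 1) ^ 2 * h2 - u 1 * v 1 * h3
    have m3 : u 0 * v 1 - v 0 * u 1 = 0 := by
      apply pow_eq_zero_iff (two_ne_zero) |>.1
      linear_combination (u 0 * v 1 + v 0 * u 1 - 2 * u 2 * v 2) * h3 - 4 * v 0 * v 1 * h1
        + 4 * u 2 * u 2 * h2
    by_cases k0 : v 0 = 0
    · by_cases k1 : v 1 = 0
      · exfalso
        have k2 : v 2 = 0 := by
          apply pow_eq_zero_iff (two_ne_zero) |>.1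
          linear_combination h2 - v 0 * k1
        apply hew
        ext i
        fin_cases i
        · exact k0
        · exact k1
        · exact k2
        · exact h5.trans k2
      · refine ⟨u 1 / v 1, hext _ ?_ ?_ ?_⟩ <;> field_simp
        · linear_combination m3
        · linear_combination -m2
    · refine ⟨u 0 / v 0, hext _ ?_ ?_ ?_⟩ <;> field_simp
      · linear_combination -m3
      · linear_combination -m1
  obtain ⟨c, hc⟩ := hex
  obtain ⟨a, ha, hv⟩ := Point.exists_vec_mk (F := orthogonal Q nd) (w : V) (hW1.1 w w.2) hw0'
  refine Point.eq_of_vec_eq_smul (c := c * a⁻¹) ?_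
  rw [hv, smul_smul, inv_mul_cancel_right₀ ha, hc]

/-- Reading the coordinate vector `(a, b, c, d)` as the matrix with rows `(a, c)` and `(-d, b)`,
whose determinant is `Q`, this is the space of the matrices annihilating the vector `(s, t)`. -/
def rulingLine (e : V ≃ₗ[K] (Fin 4 → K)) (s t : K) : Submodule K V where
  carrier := {v | s * e v 0 + t * e v 2 = 0 ∧ t * e v 1 = s * e v 3}
  zero_mem' := by simp
  add_mem' := by
    rintro u v ⟨h1, h2⟩ ⟨h3, h4⟩
    simp only [Set.mem_ofPred_eq, map_add, Pi.add_apply]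
    exact ⟨by linear_combination h1 + h3, by linear_combination h2 + h4⟩
  smul_mem' := by
    rintro c v ⟨h1, h2⟩
    simp only [Set.mem_ofPred_eq, map_smul, Pi.smul_apply, smul_eq_mul]
    exact ⟨by linear_combination c * h1, by linear_combination c * h2⟩

theorem mem_rulingLine {s t : K} {v : V} :
    v ∈ rulingLine e s t ↔ s * e v 0 + t * e v 2 = 0 ∧ t * e v 1 = s * e v 3 := Iff.rfl

theorem isMaximalSingular_rulingLine (he : ∀ v, Q v = e v 0 * e v 1 + e v 2 * e v 3) {s t : K}
    (hst : s ≠ 0 ∨ t ≠ 0) : (orthogonal Q nd).IsMaximalSingular (rulingLine e s t) := by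
  refine ⟨fun v hv => ?_, fun W hW hle v hv => ?_⟩
  · obtain ⟨h1, h2⟩ := hv
    rw [he]
    rcases hst with h | h
    · apply (mul_eq_zero.1 _).resolve_left h
      linear_combination e v 1 * h1 - e v 2 * h2
    · apply (mul_eq_zero.1 _).resolve_left h
      linear_combination e v 0 * h2 + e v 3 * h1
  · -- The line is spanned by `g` and `h`, and is also the set of vectors orthogonal to both.
    have hg : e.symm ![t, 0, -s, 0] ∈ rulingLine e s t := by
      simp [mem_rulingLine]; ring
    have hh : e.symm ![0, s, 0, t] ∈ rulingLine e s t := by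
      simp [mem_rulingLine]; ring
    have h1 := (isTotallySingular_iff.1 hW).2 _ (hle hg) v hv
    have h2 := (isTotallySingular_iff.1 hW).2 _ (hle hh) v hv
    rw [pairing_coordinates he] at h1 h2
    simp at h1 h2
    exact ⟨by linear_combination h2, by linear_combination h1⟩

theorem rulingLine_le {s t s' t' : K} (hst : s ≠ 0 ∨ t ≠ 0) (h : s * t' = t * s') :
    rulingLine e s t ≤ rulingLine e s' t' := by
  rintro v ⟨h1, h2⟩
  rcases hst with hs | ht
  · constructor
    · apply (mul_eq_zero.1 _).resolve_left hs
      linear_combination s' * h1 + e v 2 * h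
    · rw [← sub_eq_zero]
      apply (mul_eq_zero.1 _).resolve_left hs
      linear_combination s' * h2 + e v 1 * h
  · constructor
    · apply (mul_eq_zero.1 _).resolve_left ht
      linear_combination t' * h1 - e v 0 * h
    · rw [← sub_eq_zero]
      apply (mul_eq_zero.1 _).resolve_left ht
      linear_combination t' * h2 + e v 3 * h

theorem exists_isSpread_of_coordinates (he : ∀ v, Q v = e v 0 * e v 1 + e v 2 * e v 3) :
    ∃ S : Set (Submodule K V), (orthogonal Q nd).IsSpread S := by
  refine ⟨{W | ∃ s t, (s ≠ 0 ∨ t ≠ 0) ∧ W = rulingLine e s t}, ?_, fun p => ?_⟩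
  · rintro _ ⟨s, t, hst, rfl⟩
    exact isMaximalSingular_rulingLine he hst
  have hp0 : e p.vec ≠ 0 := by simpa using p.vec_ne_zero
  have hp : Q p.vec = 0 := p.isSingular
  rw [he] at hp
  obtain ⟨s, t, hst, hmem⟩ : ∃ s t, (s ≠ 0 ∨ t ≠ 0) ∧ p.vec ∈ rulingLine e s t := by
    by_cases h : e p.vec 0 = 0 ∧ e p.vec 2 = 0
    · refine ⟨e p.vec 1, e p.vec 3, ?_, ?_, mul_comm _ _⟩
      · by_contra! h'
        apply hp0
        ext i
        fin_cases i
        · exact h.1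
        · exact h'.1
        · exact h.2
        · exact h'.2
      · rw [h.1, h.2]; ring
    · refine ⟨e p.vec 2, -e p.vec 0, ?_, by ring, by linear_combination -hp⟩
      by_contra! h'
      exact h ⟨neg_eq_zero.1 h'.2, h'.1⟩
  refine ⟨rulingLine e s t, ⟨⟨s, t, hst, rfl⟩, Point.submodule_le_iff.2 hmem⟩, ?_⟩
  rintro _ ⟨⟨s', t', hst', rfl⟩, hmem'⟩
  replace hmem' := Point.submodule_le_iff.1 hmem'
  obtain ⟨h1, h2⟩ := hmem
  obtain ⟨h3, h4⟩ := hmem'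
  have h5 : s * t' = t * s' := by
    rw [← sub_eq_zero]
    by_contra hne
    apply hp0
    ext i
    refine (mul_eq_zero.1 (?_ : (s * t' - t * s') * e p.vec i = 0)).resolve_left hne
    fin_cases i <;> simp only [Fin.zero_eta, Fin.mk_one, Fin.reduceFinMk]
    · linear_combination t' * h1 - t * h3
    · linear_combination s * h4 - s' * h2
    · linear_combination s * h3 - s' * h1
    · linear_combination t * h4 - t' * h2
  exact le_antisymm (rulingLine_le hst' (by linear_combination -h5)) (rulingLine_le hst h5)

end Hyperbolic

theorem thick_or_exists_isOvoid_isSpread [Module.Finite K V] (F : ClassicalForm K V)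
    (hF' : F.RankTwo) :
    F.Thick ∨ (∃ O : Set F.Point, F.IsOvoid O) ∧ ∃ S : Set (Submodule K V), F.IsSpread S := by
  cases F with
  | symplectic B alt nd => exact .inl (thick_symplectic B alt nd)
  | unitary σ invol nontriv H herm nd => exact .inl (thick_unitary σ invol nontriv H herm nd)
  | orthogonal Q nd =>
    by_cases h : (orthogonal Q nd).Thick
    · exact .inl h
    · obtain ⟨e, he⟩ := exists_coordinates_of_not_thick Q nd hF' h
      exact .inr ⟨exists_isOvoid_of_coordinates he hF', exists_isSpread_of_coordinates he⟩

end ClassicalForm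

/-! ### Synchronization and invariant relations -/

theorem subset_semigroupGenerated {Ω : Type*} (G : Subgroup (Equiv.Perm Ω)) (a : Ω → Ω) :
    {f : Function.End Ω | f = a ∨ ∃ g ∈ G, f = (g : Ω → Ω)} ⊆ semigroupGenerated G a :=
  Subsemigroup.subset_closure

/-- A map that is not a permutation and preserves, together with `G`, a nonempty irreflexive
relation, witnesses that `G` is not synchronizing. -/
theorem not_isSynchronizingGroup_of_preserves {Ω : Type*} {G : Subgroup (Equiv.Perm Ω)}
    {R : Ω → Ω → Prop} (hirr : ∀ x, ¬ R x x) {x y : Ω} (hxy : R x y)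
    (hG : ∀ g ∈ G, ∀ x y, R x y → R (g x) (g y)) {a : Ω → Ω} (ha : ∀ x y, R x y → R (a x) (a y))
    (hbij : ¬ Function.Bijective a) : ¬ IsSynchronizingGroup G := by
  intro h
  obtain ⟨f, hf, hrank⟩ := h a hbij
  have hpres : ∀ x y, R x y → R ((f : Ω → Ω) x) ((f : Ω → Ω) y) := by
    clear hrank
    unfold semigroupGenerated at hf
    induction hf using Subsemigroup.closure_induction with
    | mem f hf =>
      rcases hf with rfl | ⟨g, hg, rfl⟩
      · exact ha
      · exact hG g hg
    | mul f g _ _ h1 h2 => exact fun x y hxy => h1 _ _ (h2 _ _ hxy)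
  obtain ⟨c, hc⟩ := Set.ncard_eq_one.1 hrank
  have h1 : (f : Ω → Ω) x = c := by simpa [hc] using Set.mem_range_self (f := (f : Ω → Ω)) x
  have h2 : (f : Ω → Ω) y = c := by simpa [hc] using Set.mem_range_self (f := (f : Ω → Ω)) y
  have := hpres x y hxy
  rw [h1, h2] at this
  exact hirr c this

/-- If `G` is not synchronizing, there are a nontrivial `G`-invariant relation `M` and a map `f`
whose fibres consist of `M`-related points while distinct points of its image are not `M`-related.
Here `M` relates the points that are identified by some map in a semigroup `⟨a, G⟩` without
elements of rank one, and `f` is an element of minimal rank of this semigroup. -/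
theorem exists_relation_of_not_isSynchronizingGroup {Ω : Type*} [Finite Ω] [Nonempty Ω]
    {G : Subgroup (Equiv.Perm Ω)} (h : ¬ IsSynchronizingGroup G) :
    ∃ (M : Ω → Ω → Prop) (f : Ω → Ω),
      (∀ g ∈ G, ∀ x y, M (g x) (g y) → M x y) ∧
      (∃ x y, x ≠ y ∧ M x y) ∧ (∃ x y, ¬ M x y) ∧ (∀ x y, f x = f y → M x y) ∧
      ∀ x y, f x ≠ f y → ¬ M (f x) (f y) := by
  simp only [IsSynchronizingGroup, not_forall] at h
  obtain ⟨a, ha, hS⟩ := h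
  set S := semigroupGenerated G a with hSdef
  have haS : (a : Function.End Ω) ∈ S := subset_semigroupGenerated G a (.inl rfl)
  have hgS : ∀ g ∈ G, ((g : Ω → Ω) : Function.End Ω) ∈ S := fun g hg =>
    subset_semigroupGenerated G a (.inr ⟨g, hg, rfl⟩)
  obtain ⟨f, hf, hmin⟩ := WellFounded.has_min
    (measure fun f : Function.End Ω => (Set.range (f : Ω → Ω)).ncard).wf {f | f ∈ S} ⟨a, haS⟩
  have hsep : ∀ x y, f x ≠ f y → ¬ ∃ h ∈ S, (h : Ω → Ω) (f x) = h (f y) := by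
    rintro x y hne ⟨h, hh, heq⟩
    have h1 : ¬ (Set.range (h * f : Function.End Ω)).ncard < (Set.range (f : Ω → Ω)).ncard :=
      hmin (h * f) (S.mul_mem hh hf)
    have h2 : Set.range (h * f : Function.End Ω) = (h : Ω → Ω) '' Set.range (f : Ω → Ω) :=
      Set.range_comp (h : Ω → Ω) (f : Ω → Ω)
    rw [h2, not_lt] at h1
    have h3 := le_antisymm (Set.ncard_image_le (f := (h : Ω → Ω)) (Set.toFinite (Set.range f))) h1
    exact hne (Set.injOn_of_ncard_image_eq h3 (Set.toFinite _) (Set.mem_range_self x)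
      (Set.mem_range_self y) heq)
  refine ⟨fun x y => ∃ h ∈ S, (h : Ω → Ω) x = h y, f, ?_, ?_, ?_, fun x y hxy => ⟨f, hf, hxy⟩,
    hsep⟩
  · rintro g hg x y ⟨h, hh, heq⟩
    exact ⟨_, S.mul_mem hh (hgS g hg), heq⟩
  · have hinj : ¬ Function.Injective a := fun h => ha (Finite.injective_iff_bijective.1 h)
    simp only [Function.Injective, not_forall] at hinj
    obtain ⟨x, y, hxy, hne⟩ := hinj
    exact ⟨x, y, hne, a, haS, hxy⟩
  · have h1 : (Set.range (f : Ω → Ω)).ncard ≠ 1 := fun h => hS ⟨f, hf, h⟩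
    have h2 : 0 < (Set.range (f : Ω → Ω)).ncard :=
      (Set.ncard_pos (Set.toFinite _)).2 (Set.range_nonempty _)
    obtain ⟨_, ⟨x, rfl⟩, _, ⟨y, rfl⟩, hne⟩ := (Set.one_lt_ncard (Set.toFinite _)).1
      (show 1 < (Set.range (f : Ω → Ω)).ncard by omega)
    exact ⟨f x, f y, hsep x y hne⟩

/-! ### Sets meeting the translates of another set in at most one point -/

section Counting

variable {Ω : Type*} [DecidableEq Ω] {G : Subgroup (Equiv.Perm Ω)} [Fintype G]

/-- In a transitive group, the number of elements moving `b` to `a` does not depend on `a`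
and `b`. -/
theorem card_filter_apply_eq (hG : ∀ x y : Ω, ∃ g ∈ G, g x = y) (a b a' b' : Ω) :
    (Finset.univ.filter fun g : G => g.1 b = a).card =
      (Finset.univ.filter fun g : G => g.1 b' = a').card := by
  have key : ∀ a b a' b' : Ω, (Finset.univ.filter fun g : G => g.1 b = a).card ≤
      (Finset.univ.filter fun g : G => g.1 b' = a').card := by
    intro a b a' b'
    obtain ⟨h, hh, hha⟩ := hG a a'
    obtain ⟨k, hk, hkb⟩ := hG b' b
    refine Finset.card_le_card_of_injOn (fun g => ⟨h, hh⟩ * g * ⟨k, hk⟩) ?_ ?_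
    · intro g hg
      have : g.1 b = a := by simpa using hg
      simp [hkb, this, hha]
    · intro g _ g' _ heq
      simpa using heq
  exact le_antisymm (key _ _ _ _) (key _ _ _ _)

/-- The clique-coclique bound, by counting the triples `(g, a, b)` with `g b = a`; if it is
attained, every translate of `B`, and in particular `B` itself, meets `A`. -/
theorem card_mul_card_le_and_exists_mem [Fintype Ω] [Nonempty Ω]
    (hG : ∀ x y : Ω, ∃ g ∈ G, g x = y) {A B : Finset Ω}
    (hAB : ∀ g ∈ G, ∀ b ∈ B, ∀ b' ∈ B, g b ∈ A → g b' ∈ A → b = b') :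
    A.card * B.card ≤ Fintype.card Ω ∧
      (A.card * B.card = Fintype.card Ω → ∃ b ∈ B, b ∈ A) := by
  obtain ⟨x⟩ := ‹Nonempty Ω›
  set s := (Finset.univ.filter fun g : G => g.1 x = x).card with hs
  have hs0 : 0 < s := Finset.card_pos.2 ⟨1, by simp⟩
  have hsΩ : Fintype.card Ω * s = Fintype.card G := by
    have h1 := Finset.card_eq_sum_card_fiberwise (s := (Finset.univ : Finset G))
      (t := (Finset.univ : Finset Ω)) (f := fun g => g.1 x) (fun _ _ => Finset.mem_univ _)
    rw [Finset.sum_congr rfl fun a _ => card_filter_apply_eq hG a x x x] at h1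
    simpa [hs] using h1.symm
  let t : G → ℕ := fun g => ((A ×ˢ B).filter fun ab => g.1 ab.2 = ab.1).card
  have ht1 : ∀ g ∈ (Finset.univ : Finset G), t g ≤ 1 := by
    intro g _
    refine Finset.card_le_one.2 ?_
    rintro ⟨a, b⟩ h ⟨a', b'⟩ h'
    simp only [Finset.mem_filter, Finset.mem_product] at h h'
    obtain ⟨⟨ha, hb⟩, rfl⟩ := h
    obtain ⟨⟨ha', hb'⟩, rfl⟩ := h'
    rw [hAB g.1 g.2 b hb b' hb' ha ha']
  have hsum : ∑ g : G, t g = A.card * B.card * s := by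
    simp only [t, Finset.card_filter]
    rw [Finset.sum_comm, ← Finset.card_product, ← smul_eq_mul, ← Finset.sum_const]
    refine Finset.sum_congr rfl fun ab _ => ?_
    rw [← Finset.card_filter]
    exact card_filter_apply_eq hG _ _ _ _
  have hle : ∑ g : G, t g ≤ Fintype.card G := by
    simpa using Finset.sum_le_sum ht1
  rw [hsum, ← hsΩ] at hle
  refine ⟨Nat.le_of_mul_le_mul_right hle hs0, fun heq => ?_⟩
  have hall : ∀ g ∈ (Finset.univ : Finset G), t g = 1 := by
    rw [← Finset.sum_eq_sum_iff_of_le ht1, hsum, heq, hsΩ]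
    simp
  have h1 : 0 < t 1 := by
    rw [hall 1 (Finset.mem_univ _)]
    exact one_pos
  obtain ⟨⟨a, b⟩, hab⟩ := Finset.card_pos.1 h1
  simp only [Finset.mem_filter, Finset.mem_product] at hab
  obtain ⟨⟨ha, hb⟩, h2⟩ := hab
  exact ⟨b, hb, by simpa [← h2] using ha⟩

end Counting

namespace ClassicalForm

variable {K V : Type*} [Field K] [AddCommGroup V] [Module K V]
variable {F : ClassicalForm K V}

/-! ### Classical groups -/

/-- An isometry of the derived subgroup induces an element of every classical group. -/
theorem IsClassicalGroup.exists_mem {G : Subgroup (Equiv.Perm F.Point)} (hG : F.IsClassicalGroup G)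
    {d : F.isometryGroup} (hd : d ∈ commutator F.isometryGroup) :
    ∃ g ∈ G, ∀ (p q : F.Point) (c : K), c ≠ 0 → d.1 p.vec = c • q.vec → g p = q := by
  refine ⟨MulAction.toPermHom F.isometryGroup F.Point d, hG.1 (Subgroup.mem_map_of_mem _ hd),
    fun p q c hc h => Point.submodule_inj ?_⟩
  change ((d : V ≃ₗ[K] V) • p.1).submodule = q.submodule
  rw [submodule_smul]
  change p.submodule.map _ = _
  rw [p.submodule_eq, q.submodule_eq, Submodule.map_span, Set.image_singleton]
  change Submodule.span K {d.1 p.vec} = _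
  rw [h, Submodule.span_singleton_smul_eq hc.isUnit]

variable [Module.Finite K V] {G : Subgroup (Equiv.Perm F.Point)}

theorem IsClassicalGroup.exists_apply_eq (hG : F.IsClassicalGroup G) (hF : F.Thick)
    (hF' : F.RankTwo) (p q : F.Point) : ∃ g ∈ G, g p = q := by
  obtain ⟨d, hd, c, hc, h⟩ := hF.exists_commutator_point hF' p.isSingular q.isSingular
    p.vec_ne_zero q.vec_ne_zero
  obtain ⟨g, hg, hg'⟩ := hG.exists_mem hd
  exact ⟨g, hg, hg' p q c hc h⟩

theorem IsClassicalGroup.exists_apply_eq_of_not_collinear (hG : F.IsClassicalGroup G)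
    (hF : F.Thick) (hF' : F.RankTwo) {p q p' q' : F.Point} (h : ¬ F.Collinear p q)
    (h' : ¬ F.Collinear p' q') : ∃ g ∈ G, g p = p' ∧ g q = q' := by
  rw [collinear_iff] at h h'
  obtain ⟨d, hd, ⟨c, hc, h1⟩, c', hc', h2⟩ := hF.exists_commutator_not_orthogonal hF'
    p.isSingular q.isSingular p'.isSingular q'.isSingular h h'
  obtain ⟨g, hg, hg'⟩ := hG.exists_mem hd
  exact ⟨g, hg, hg' _ _ c hc h1, hg' _ _ c' hc' h2⟩

theorem IsClassicalGroup.exists_apply_eq_of_collinear (hG : F.IsClassicalGroup G)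
    (hF : F.Thick) (hF' : F.RankTwo) {p q p' q' : F.Point} (h : F.Collinear p q)
    (h' : F.Collinear p' q') (hne : p ≠ q) (hne' : p' ≠ q') :
    ∃ g ∈ G, g p = p' ∧ g q = q' := by
  rw [collinear_iff] at h h'
  obtain ⟨d, hd, ⟨c, hc, h1⟩, c', hc', h2⟩ := hF.exists_commutator_orthogonal hF'
    p.isSingular q.isSingular p'.isSingular q'.isSingular p.vec_ne_zero p'.vec_ne_zero h h'
    (Point.vec_ne_smul hne.symm) (Point.vec_ne_smul hne'.symm)
  obtain ⟨g, hg, hg'⟩ := hG.exists_mem hd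
  exact ⟨g, hg, hg' _ _ c hc h1, hg' _ _ c' hc' h2⟩

/-- The action has rank three: the only nontrivial reflexive invariant relations are collinearity
and "equal or not collinear". -/
theorem IsClassicalGroup.relation_eq (hG : F.IsClassicalGroup G) (hF : F.Thick) (hF' : F.RankTwo)
    {M : F.Point → F.Point → Prop} (hM : ∀ g ∈ G, ∀ x y, M (g x) (g y) → M x y)
    (hrefl : ∀ x, M x x) (h1 : ∃ x y, x ≠ y ∧ M x y) (h2 : ∃ x y, ¬ M x y) :
    (∀ x y, M x y ↔ F.Collinear x y) ∨ ∀ x y, M x y ↔ x = y ∨ ¬ F.Collinear x y := by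
  have hcol : ∀ x y x' y', F.Collinear x y → F.Collinear x' y' → x ≠ y → x' ≠ y' → M x y →
      M x' y' := by
    intro x y x' y' h h' hne hne' hxy
    obtain ⟨g, hg, rfl, rfl⟩ := hG.exists_apply_eq_of_collinear hF hF' h' h hne' hne
    exact hM g hg _ _ hxy
  have hncol : ∀ x y x' y', ¬ F.Collinear x y → ¬ F.Collinear x' y' → M x y → M x' y' := by
    intro x y x' y' h h' hxy
    obtain ⟨g, hg, rfl, rfl⟩ := hG.exists_apply_eq_of_not_collinear hF hF' h' h
    exact hM g hg _ _ hxy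
  obtain ⟨u, v, huv, hMuv⟩ := h1
  obtain ⟨a, b, hab⟩ := h2
  have hne : a ≠ b := by
    rintro rfl
    exact hab (hrefl a)
  by_cases hc : F.Collinear u v
  · have hc' : ¬ F.Collinear a b := fun h => hab (hcol u v a b hc h huv hne hMuv)
    refine .inl fun x y => ⟨fun hxy => ?_, fun hxy => ?_⟩
    · by_contra h
      exact hab (hncol x y a b h hc' hxy)
    · by_cases heq : x = y
      · exact heq ▸ hrefl x
      · exact hcol u v x y hc hxy huv heq hMuv
  · have hc' : F.Collinear a b := by
      by_contra h
      exact hab (hncol u v a b hc h hMuv)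
    refine .inr fun x y => ⟨fun hxy => ?_, ?_⟩
    · by_contra! h
      exact hab (hcol x y a b h.2 hc' h.1 hne hxy)
    · rintro (rfl | h)
      · exact hrefl x
      · exact hncol u v x y hc h hMuv

/-! ### From ovoids and spreads to endomorphisms -/

theorem IsOvoid.eq_of_collinear {O : Set F.Point} (hO : F.IsOvoid O) {p q : F.Point} (hp : p ∈ O)
    (hq : q ∈ O) (h : F.Collinear p q) : p = q := by
  obtain ⟨M, hM, h1, h2⟩ := h.exists_isMaximalSingular
  exact (hO M hM).unique ⟨hp, h1⟩ ⟨hq, h2⟩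

theorem RankTwo.exists_ne_mem (hF' : F.RankTwo) {W : Submodule K V} (hW : F.IsMaximalSingular W)
    (p : F.Point) : ∃ q : F.Point, q ≠ p ∧ q.submodule ≤ W := by
  by_contra! h
  have h1 : W ≤ Submodule.span K {p.vec} := by
    intro x hx
    by_cases hx0 : x = 0
    · simp [hx0]
    · have hxs := (isTotallySingular_iff.1 hW.1).1 x hx
      have h2 : Point.mk x hxs hx0 = p := by
        by_contra hne
        exact h _ hne (Point.mk_le_iff.2 hx)
      rw [← p.submodule_eq, ← h2, Point.submodule_mk]
      exact Submodule.mem_span_singleton_self x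
  have h2 := Submodule.finrank_mono h1
  have h3 := hF'.two_le_finrank hW
  rw [finrank_span_singleton p.vec_ne_zero] at h2
  omega

/-- The map sending each point to the point of the ovoid on its spread element preserves
non-collinearity. -/
theorem not_isSynchronizingGroup_of_isOvoid_isSpread (hF' : F.RankTwo)
    (hG : ∀ g ∈ G, F.IsAutomorphism g) {O : Set F.Point} (hO : F.IsOvoid O)
    {S : Set (Submodule K V)} (hS : F.IsSpread S) : ¬ IsSynchronizingGroup G := by
  choose W hW hWu using hS.2
  have hmax : ∀ p, F.IsMaximalSingular (W p) := fun p => hS.1 _ (hW p).1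
  choose a ha hau using fun p => hO (W p) (hmax p)
  have key : ∀ p q, q.submodule ≤ W p → W q = W p := fun p q h =>
    (hWu q (W p) ⟨(hW p).1, h⟩).symm
  have hcong : ∀ p q, W p = W q → a p = a q := fun p q h =>
    hau q (a p) ⟨(ha p).1, h ▸ (ha p).2⟩
  obtain ⟨p⟩ := hF'.nonempty_point
  obtain ⟨q, hpq⟩ := exists_not_collinear p
  refine not_isSynchronizingGroup_of_preserves (R := fun x y => ¬ F.Collinear x y)
    (fun x h => h (collinear_self x)) hpq (fun g hg x y h => (hG g hg x y).not.2 h)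
    (a := a) ?_ ?_
  · intro x y hxy hcol
    have h1 : a x = a y := hO.eq_of_collinear (ha x).1 (ha y).1 hcol
    have h2 : W x = W y :=
      (key x (a x) (ha x).2).symm.trans (by rw [h1]; exact key y (a y) (ha y).2)
    exact hxy ((hmax x).1.collinear (hW x).2 (h2 ▸ (hW y).2))
  · intro hbij
    obtain ⟨r, hne, hr⟩ := hF'.exists_ne_mem (hmax p) p
    exact hne (hbij.1 (hcong r p (key p r hr)))

/-- For a maximal totally singular subspace `W`, the map sending each point to the point of `W` in
the same ovoid preserves the relation "distinct and collinear". -/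
theorem not_isSynchronizingGroup_of_isOvoidPartition (hF' : F.RankTwo)
    (hG : ∀ g ∈ G, F.IsAutomorphism g) {P : Set (Set F.Point)} (hP : F.IsOvoidPartition P) :
    ¬ IsSynchronizingGroup G := by
  obtain ⟨U, hU, -⟩ := id hF'
  obtain ⟨W, hW, -⟩ := exists_isMaximalSingular_ge hU
  choose O hO hOu using hP.1.2
  choose a ha hau using fun p => hP.2 (O p) (hO p).1 W hW
  obtain ⟨p⟩ := hF'.nonempty_point
  obtain ⟨q, hne, hpq⟩ := hF'.exists_collinear_ne p
  refine not_isSynchronizingGroup_of_preserves (R := fun x y => x ≠ y ∧ F.Collinear x y)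
    (fun x h => h.1 rfl) (x := p) (y := q) ⟨hne.symm, hpq⟩
    (fun g hg x y h => ⟨fun h' => h.1 (g.injective h'), (hG g hg x y).2 h.2⟩)
    (a := a) ?_ ?_
  · rintro x y ⟨hxy, hcol⟩
    refine ⟨fun heq => hxy ?_, hW.1.collinear (ha x).2 (ha y).2⟩
    have h1 : O (a x) = O x := (hOu (a x) (O x) ⟨(hO x).1, (ha x).1⟩).symm
    have h2 : O (a y) = O y := (hOu (a y) (O y) ⟨(hO y).1, (ha y).1⟩).symm
    have h3 : O x = O y := by rw [← h1, ← h2, heq]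
    exact (hP.2 (O x) (hO x).1).eq_of_collinear (hO x).2 (h3 ▸ (hO y).2) hcol
  · intro hbij
    -- A point not collinear with some point of `W` is not in the image.
    obtain ⟨r, hr⟩ := exists_not_collinear (a p)
    obtain ⟨s, rfl⟩ := hbij.2 r
    exact hr (hW.1.collinear (ha p).2 (ha s).2)

/-! ### From endomorphisms to ovoids and spreads -/

/-- A map of the points that is injective on cliques of the collinearity graph and whose image is
a clique is a colouring of this graph by the points of a maximal totally singular subspace; the
colour classes are ovoids. -/
theorem exists_isOvoidPartition [Finite K] {f : F.Point → F.Point}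
    (h1 : ∀ x y, f x = f y → F.Collinear x y → x = y) (h2 : ∀ x y, F.Collinear (f x) (f y)) :
    ∃ P : Set (Set F.Point), F.IsOvoidPartition P := by
  obtain ⟨W, hW, hfW⟩ := exists_isMaximalSingular_of_pairwise (C := Set.range f) (by
    rintro _ ⟨x, rfl⟩ _ ⟨y, rfl⟩
    exact h2 x y)
  refine ⟨(Setoid.ker f).classes, Setoid.isPartition_classes _, ?_⟩
  rintro _ ⟨y, rfl⟩ U hU
  have hinj : Set.InjOn f (F.pointsOf U) := fun x hx z hz hxz =>
    h1 x z hxz (hU.1.collinear hx hz)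
  have hsurj : f '' F.pointsOf U = F.pointsOf W := by
    refine Set.eq_of_subset_of_ncard_le ?_ ?_ (Set.toFinite _)
    · rintro _ ⟨x, -, rfl⟩
      exact hfW _ (Set.mem_range_self x)
    · rw [hinj.ncard_image, hU.ncard_pointsOf_eq hW]
  obtain ⟨x, hx, hxy⟩ : f y ∈ f '' F.pointsOf U := by
    rw [hsurj]
    exact hfW _ (Set.mem_range_self y)
  refine ⟨x, ⟨hxy, hx⟩, ?_⟩
  rintro z ⟨hzy, hz⟩
  exact hinj hz hx (Eq.trans hzy hxy.symm)

/-- If the fibres of a map are cliques of the collinearity graph and its image is a coclique, then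
the clique-coclique bound is attained: the fibres are the point sets of the elements of a spread and
the image is an ovoid. -/
theorem exists_isOvoid_isSpread [Finite K] (hF' : F.RankTwo)
    (haut : ∀ g ∈ G, F.IsAutomorphism g) (htrans : ∀ p q : F.Point, ∃ g ∈ G, g p = q)
    {f : F.Point → F.Point} (h1 : ∀ x y, f x = f y → F.Collinear x y)
    (h2 : ∀ x y, F.Collinear (f x) (f y) → f x = f y) :
    (∃ O : Set F.Point, F.IsOvoid O) ∧ ∃ S : Set (Submodule K V), F.IsSpread S := by
  classical
  have := Fintype.ofFinite F.Point
  have := Fintype.ofFinite G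
  have := hF'.nonempty_point
  let A : Finset F.Point := Finset.univ.image f
  let B : Submodule K V → Finset F.Point := fun W => Finset.univ.filter fun p => p.submodule ≤ W
  have hBmem : ∀ W p, p ∈ B W ↔ p.submodule ≤ W := by simp [B]
  have hBcard : ∀ U W, F.IsMaximalSingular U → F.IsMaximalSingular W →
      (B U).card = (B W).card := by
    intro U W hU hW
    have h := hU.ncard_pointsOf_eq hW
    have hB : ∀ W, (B W : Set F.Point) = F.pointsOf W := fun W => Set.ext fun p => hBmem W p
    rwa [← hB, ← hB, Set.ncard_coe_finset, Set.ncard_coe_finset] at h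
  have hbound := fun W (hW : F.IsMaximalSingular W) =>
    card_mul_card_le_and_exists_mem (G := G) htrans (A := A) (B := B W) (by
      intro g hg b hb b' hb' hgb hgb'
      obtain ⟨x, -, hx⟩ := Finset.mem_image.1 hgb
      obtain ⟨y, -, hy⟩ := Finset.mem_image.1 hgb'
      have hcol : F.Collinear (g b) (g b') :=
        (haut g hg b b').2 (hW.1.collinear ((hBmem _ _).1 hb) ((hBmem _ _).1 hb'))
      rw [← hx, ← hy] at hcol
      have := h2 x y hcol
      rw [hx, hy] at this
      exact g.injective this)
  have hfib : ∀ c : F.Point, ∃ M, F.IsMaximalSingular M ∧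
      ∀ p ∈ {p | f p = c}, p.submodule ≤ M := fun c =>
    exists_isMaximalSingular_of_pairwise fun p hp q hq => h1 p q (Eq.trans hp (Eq.symm hq))
  choose M hM hfM using hfib
  have hsub : ∀ c, (Finset.univ.filter fun p => f p = c) ⊆ B (M c) := fun c p hp =>
    (hBmem _ _).2 (hfM c p (Finset.mem_filter.1 hp).2)
  have hsum : Fintype.card F.Point = ∑ c ∈ A, (Finset.univ.filter fun p => f p = c).card :=
    Finset.card_eq_sum_card_fiberwise fun p _ => Finset.mem_image_of_mem f (Finset.mem_univ p)
  have hsumB : ∀ W, F.IsMaximalSingular W → ∑ c ∈ A, (B (M c)).card = A.card * (B W).card := by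
    intro W hW
    rw [Finset.sum_congr rfl fun c _ => hBcard _ W (hM c) hW, Finset.sum_const, smul_eq_mul]
  have heq : ∀ W, F.IsMaximalSingular W → A.card * (B W).card = Fintype.card F.Point := by
    intro W hW
    refine le_antisymm (hbound W hW).1 ?_
    rw [hsum, ← hsumB W hW]
    exact Finset.sum_le_sum fun c _ => Finset.card_le_card (hsub c)
  refine ⟨⟨Set.range f, fun W hW => ?_⟩, {W | ∃ c ∈ A, W = M c}, ?_, fun p => ?_⟩
  · obtain ⟨b, hb, hbA⟩ := (hbound W hW).2 (heq W hW)
    obtain ⟨x, -, rfl⟩ := Finset.mem_image.1 hbA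
    refine ⟨f x, ⟨Set.mem_range_self x, (hBmem _ _).1 hb⟩, ?_⟩
    rintro _ ⟨⟨y, rfl⟩, hy⟩
    exact h2 y x (hW.1.collinear hy ((hBmem _ _).1 hb))
  · rintro _ ⟨c, -, rfl⟩
    exact hM c
  · have hfibre : ∀ c ∈ A, (Finset.univ.filter fun p => f p = c) = B (M c) := by
      intro c hc
      refine Finset.eq_of_subset_of_card_le (hsub c) (le_of_eq ?_)
      refine ((Finset.sum_eq_sum_iff_of_le fun c _ => Finset.card_le_card (hsub c)).1 ?_ c hc).symm
      rw [← hsum, hsumB (M c) (hM c), heq _ (hM c)]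
    refine ⟨M (f p), ⟨⟨f p, Finset.mem_image_of_mem f (Finset.mem_univ p), rfl⟩, hfM _ p rfl⟩, ?_⟩
    rintro _ ⟨⟨c, hc, rfl⟩, hp⟩
    have hpc : p ∈ Finset.univ.filter fun p => f p = c := by
      rw [hfibre c hc]
      exact (hBmem _ _).2 hp
    rw [(Finset.mem_filter.1 hpc).2]

end ClassicalForm

theorem mainTheorem5 {K V : Type*} [Field K] [Finite K] [AddCommGroup V] [Module K V]
    [Module.Finite K V] (F : ClassicalForm K V)
    (hrank : ∃ W : Submodule K V, F.IsTotallySingular W ∧ 2 ≤ Module.finrank K W)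
    (G : Subgroup (Equiv.Perm F.Point)) (hG : F.IsClassicalGroup G) :
    ¬ IsSynchronizingGroup G ↔
      ((∃ O : Set F.Point, F.IsOvoid O) ∧ (∃ S : Set (Submodule K V), F.IsSpread S)) ∨
        ∃ P : Set (Set F.Point), F.IsOvoidPartition P := by
  have hF' : F.RankTwo := hrank
  constructor
  · intro h
    rcases F.thick_or_exists_isOvoid_isSpread hF' with hF | hOS
    swap
    · exact .inl hOS
    have := hF'.nonempty_point
    obtain ⟨M, f, hM, hM1, hM2, hf1, hf2⟩ := exists_relation_of_not_isSynchronizingGroup h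
    rcases hG.relation_eq hF hF' hM (fun x => hf1 x x rfl) hM1 hM2 with hcol | hncol
    · refine .inl (ClassicalForm.exists_isOvoid_isSpread hF' hG.2 (hG.exists_apply_eq hF hF')
        (f := f) (fun x y hxy => (hcol x y).1 (hf1 x y hxy)) fun x y hxy => ?_)
      by_contra hne
      exact hf2 x y hne ((hcol _ _).2 hxy)
    · refine .inr (ClassicalForm.exists_isOvoidPartition (f := f) (fun x y hxy hc => ?_)
        fun x y => ?_)
      · exact ((hncol x y).1 (hf1 x y hxy)).resolve_right (not_not.2 hc)
      · by_contra hc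
        refine hf2 x y (fun heq => hc ?_) ((hncol _ _).2 (.inr hc))
        rw [heq]
        exact ClassicalForm.collinear_self _
  · rintro (⟨⟨O, hO⟩, S, hS⟩ | ⟨P, hP⟩)
    · exact ClassicalForm.not_isSynchronizingGroup_of_isOvoid_isSpread hF' hG.2 hO hS
    · exact ClassicalForm.not_isSynchronizingGroup_of_isOvoidPartition hF' hG.2 hP
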